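/- For a finite set $P\subset\mathbb{R}^d$ and an integer $k\ge 1$ let $$\mathrm{OPT}_k(P)=\inf_{C\subset\mathbb{R}^d,\ |C|=k}\ \max_{p\in P}\ \min_{c\in C}\|p-c\|_2$$ be the $k$-Center cost value of $P$. The computational model is a randomized real RAM: a program has integer cells (natural numbers) and real cells, organized in arrays that are accessed by computed integer indices; each of the following takes one step: reading or writing a cell, an integer constant, addition, truncated subtraction or comparison, a rational constant, a real $+,-,\times,\div$ or comparison, a Boolean connective or branching operation, and drawing a fresh independent sample of $\mathcal N(0,1)$. There is an $e\in\mathbb{N}$ such that for every $c\in\mathbb{N}$ there are a program $A$, an exponent $a\in\mathbb{N}$ and a constant $K$ (depending only on $c$) such that the following holds for all integers $n,d,k\ge 1$ and every set $P\subset\mathbb{R}^d$ with $|P|=n$. Given $n$, $d$, $k$ and the coordinates of the points of $P$ (listed in any order), $A$ always halts within $K\,(nd+n(\log n)^e)$ steps, and it outputs a number $\mathrm{apx}$ such that, with probability at least $1-n^{-c}$, $$\mathrm{OPT}_k(P)\ \le\ \mathrm{apx}\ \le\ n^{a}\cdot \mathrm{OPT}_k(P).$$ Moreover, a Gaussian projection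 to one dimension distorts all pairwise distances by at most a polynomial factor: for every $c\in\mathbb{N}$ there is an $a\in\mathbb{N}$ such that, for all $n,d\ge1$, every $P\subset\mathbb{R}^d$ with $|P|=n$, and $v\sim\mathcal N(0,I_d)$, with probability at least $1-n^{-c}$ all $x,y\in P$ satisfy $$\frac{\|x-y\|_2}{n^{a}}\ \le\ |\langle v,x\rangle-\langle v,y\rangle|\ \le\ n^{a}\,\|x-y\|_2 .$$ -/

import Mathlib

open MeasureTheory ProbabilityTheory

/-! The Euclidean `k`-Center problem. -/

/-- `cost(P, C) = max_{p ∈ P} dist(p, C)`, for a finite set `P` of points and a finite set `C` of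
centers, where `dist(p, C) = min_{c ∈ C} dist(p, c)`. -/
noncomputable def clusterCost {E : Type*} [PseudoMetricSpace E] (P : Set E) (C : Finset E) : ℝ :=
  ⨆ p : P, Metric.infDist (p : E) (C : Set E)

/-- The optimal `k`-Center value of `P`: the infimum of `cost(P, C)` over all sets `C` of exactly
`k` centers of the ambient space. -/
noncomputable def kCenterOpt {E : Type*} [PseudoMetricSpace E] (P : Set E) (k : ℕ) : ℝ :=
  ⨅ C : {C : Finset E // C.card = k}, clusterCost P C.1

/-! A randomized real RAM, presented as a structured programming language with unit-cost
operations. The memory consists of integer cells (holding natural numbers) and of real cells, each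
kind organized in arrays: a cell is addressed by the name of its array, which is fixed in the text
of the program, and by a computed natural-number index. -/

namespace RealRAM

/-- Integer expressions: constants, reading an integer cell, sum and truncated difference. -/
inductive IExp : Type
  | const (c : ℕ)
  | get (a : ℕ) (i : IExp)
  | plus (e f : IExp)
  | minus (e f : IExp)

/-- Real expressions: rational constants, reading a real cell, and the four field operations
(division by zero returns zero). -/
inductive RExp : Type
  | const (q : ℚ)
  | get (a : ℕ) (i : IExp)
  | plus (e f : RExp)
  | minus (e f : RExp)
  | times (e f : RExp)
  | over (e f : RExp)

/-- Tests: comparisons of two integers or of two reals, and Boolean combinations. -/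
inductive BExp : Type
  | intLt (e f : IExp)
  | realLt (e f : RExp)
  | neg (b : BExp)
  | both (b b' : BExp)

/-- Programs. A program is a finite object; in particular it cannot depend on the input. -/
inductive Prog : Type
  | skip
  /-- store the value of `e` in cell `i` of the integer array `a` -/
  | putInt (a : ℕ) (i e : IExp)
  /-- store the value of `e` in cell `i` of the real array `a` -/
  | putReal (a : ℕ) (i : IExp) (e : RExp)
  /-- store a fresh standard Gaussian sample in cell `i` of the real array `a` -/
  | gauss (a : ℕ) (i : IExp)
  | seq (c c' : Prog)
  | branch (b : BExp) (c c' : Prog)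
  | loop (b : BExp) (c : Prog)

/-- Memory contents, and the number of random samples drawn so far. -/
structure State : Type where
  ints : ℕ → ℕ → ℕ
  reals : ℕ → ℕ → ℝ
  drawn : ℕ

def IExp.eval (s : State) : IExp → ℕ
  | .const c => c
  | .get a i => s.ints a (i.eval s)
  | .plus e f => e.eval s + f.eval s
  | .minus e f => e.eval s - f.eval s

noncomputable def RExp.eval (s : State) : RExp → ℝ
  | .const q => (q : ℝ)
  | .get a i => s.reals a (i.eval s)
  | .plus e f => e.eval s + f.eval s
  | .minus e f => e.eval s - f.eval s
  | .times e f => e.eval s * f.eval s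
  | .over e f => e.eval s / f.eval s

def BExp.holds (s : State) : BExp → Prop
  | .intLt e f => e.eval s < f.eval s
  | .realLt e f => e.eval s < f.eval s
  | .neg b => ¬ b.holds s
  | .both b b' => b.holds s ∧ b'.holds s

/-! The cost of evaluating an expression is its number of operations. -/

def IExp.cost : IExp → ℕ
  | .const _ => 1
  | .get _ i => i.cost + 1
  | .plus e f => e.cost + f.cost + 1
  | .minus e f => e.cost + f.cost + 1

def RExp.cost : RExp → ℕ
  | .const _ => 1
  | .get _ i => i.cost + 1
  | .plus e f => e.cost + f.cost + 1
  | .minus e f => e.cost + f.cost + 1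
  | .times e f => e.cost + f.cost + 1
  | .over e f => e.cost + f.cost + 1

def BExp.cost : BExp → ℕ
  | .intLt e f => e.cost + f.cost + 1
  | .realLt e f => e.cost + f.cost + 1
  | .neg b => b.cost + 1
  | .both b b' => b.cost + b'.cost + 1

def State.putInt (s : State) (a i v : ℕ) : State :=
  { s with ints := Function.update s.ints a (Function.update (s.ints a) i v) }

def State.putReal (s : State) (a i : ℕ) (x : ℝ) : State :=
  { s with reals := Function.update s.reals a (Function.update (s.reals a) i x) }

/-- `Exec ω c s t s'`: if the successive random samples are `ω 0, ω 1, …`, then the program `c`,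
started in state `s`, halts in state `s'` after exactly `t` steps. -/
inductive Exec (ω : ℕ → ℝ) : Prog → State → ℕ → State → Prop
  | skip (s : State) : Exec ω .skip s 1 s
  | putInt (s : State) (a : ℕ) (i e : IExp) :
      Exec ω (.putInt a i e) s (i.cost + e.cost + 1) (s.putInt a (i.eval s) (e.eval s))
  | putReal (s : State) (a : ℕ) (i : IExp) (e : RExp) :
      Exec ω (.putReal a i e) s (i.cost + e.cost + 1) (s.putReal a (i.eval s) (e.eval s))
  | gauss (s : State) (a : ℕ) (i : IExp) :
      Exec ω (.gauss a i) s (i.cost + 1)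
        { s.putReal a (i.eval s) (ω s.drawn) with drawn := s.drawn + 1 }
  | seq {c c' : Prog} {s s' s'' : State} {t t' : ℕ} :
      Exec ω c s t s' → Exec ω c' s' t' s'' → Exec ω (.seq c c') s (t + t') s''
  | branchTrue {b : BExp} {c c' : Prog} {s s' : State} {t : ℕ} :
      b.holds s → Exec ω c s t s' → Exec ω (.branch b c c') s (b.cost + t + 1) s'
  | branchFalse {b : BExp} {c c' : Prog} {s s' : State} {t : ℕ} :
      ¬ b.holds s → Exec ω c' s t s' → Exec ω (.branch b c c') s (b.cost + t + 1) s'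
  | loopTrue {b : BExp} {c : Prog} {s s' s'' : State} {t t' : ℕ} :
      b.holds s → Exec ω c s t s' → Exec ω (.loop b c) s' t' s'' →
        Exec ω (.loop b c) s (b.cost + t + t' + 1) s''
  | loopFalse {b : BExp} {c : Prog} {s : State} :
      ¬ b.holds s → Exec ω (.loop b c) s (b.cost + 1) s

/-- Running times and final states are determined by the program, the input and the samples. -/
theorem Exec.unique {ω : ℕ → ℝ} {c : Prog} {s s₁ s₂ : State} {t₁ t₂ : ℕ}
    (h₁ : Exec ω c s t₁ s₁) (h₂ : Exec ω c s t₂ s₂) : t₁ = t₂ ∧ s₁ = s₂ := by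
  induction h₁ generalizing t₂ s₂ with
  | skip => cases h₂; exact ⟨rfl, rfl⟩
  | putInt => cases h₂; exact ⟨rfl, rfl⟩
  | putReal => cases h₂; exact ⟨rfl, rfl⟩
  | gauss => cases h₂; exact ⟨rfl, rfl⟩
  | seq _ _ ih ih' =>
    cases h₂ with
    | seq k k' =>
      obtain ⟨rfl, rfl⟩ := ih k
      obtain ⟨rfl, rfl⟩ := ih' k'
      exact ⟨rfl, rfl⟩
  | branchTrue hb _ ih =>
    cases h₂ with
    | branchTrue _ k => obtain ⟨rfl, rfl⟩ := ih k; exact ⟨rfl, rfl⟩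
    | branchFalse nb _ => exact absurd hb nb
  | branchFalse hb _ ih =>
    cases h₂ with
    | branchTrue nb _ => exact absurd nb hb
    | branchFalse _ k => obtain ⟨rfl, rfl⟩ := ih k; exact ⟨rfl, rfl⟩
  | loopTrue hb _ _ ih ih' =>
    cases h₂ with
    | loopTrue _ k k' =>
      obtain ⟨rfl, rfl⟩ := ih k
      obtain ⟨rfl, rfl⟩ := ih' k'
      exact ⟨rfl, rfl⟩
    | loopFalse nb => exact absurd hb nb
  | loopFalse hb =>
    cases h₂ with
    | loopTrue nb _ _ => exact absurd nb hb
    | loopFalse _ => exact ⟨rfl, rfl⟩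

/-- The initial state for the points `p 0, …, p (n - 1)` of `ℝ^d` and the number `k`: integer
array `0` starts with `n, d, k`, real array `0` starts with the `n * d` coordinates (coordinate `j`
of point `i` in cell `i * d + j`), and all other cells are zero. -/
noncomputable def initState {n d : ℕ} (p : Fin n → EuclideanSpace ℝ (Fin d)) (k : ℕ) : State where
  ints a m := if a = 0 then (if m = 0 then n else if m = 1 then d else if m = 2 then k else 0) else 0
  reals a m :=
    if a = 0 then (if h : m < n * d then p (Fin.divNat ⟨m, h⟩) (Fin.modNat ⟨m, h⟩) else 0) else 0
  drawn := 0

/-- On input `p, k` and with random samples `ω`, the program `c` halts after at most `T` steps and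
outputs the real number `r`, which is then found in cell `0` of real array `1`. -/
def OutputsWithin {n d : ℕ} (c : Prog) (p : Fin n → EuclideanSpace ℝ (Fin d)) (k : ℕ)
    (ω : ℕ → ℝ) (T r : ℝ) : Prop :=
  ∃ (t : ℕ) (s : State), Exec ω c (initState p k) t s ∧ (t : ℝ) ≤ T ∧ s.reals 1 0 = r

/-- The law of an infinite sequence of independent standard Gaussian samples. -/
noncomputable def gaussianSamples : Measure (ℕ → ℝ) :=
  Measure.infinitePi (fun _ : ℕ => gaussianReal 0 1)

end RealRAM

/-! For fixed `x ≠ y`, the number `⟨v, x - y⟩ / ‖x - y‖` is a standard normal variable. It lies in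
`[-1/t, 1/t]` with probability at most `1/t`, since its density is bounded, and outside `(-t, t)`
with probability at most `1/t²`, by Chebyshev. With `t = n^(c+3)`, a union bound over the `n²`
ordered pairs leaves a failure probability of at most `(2/n) n^(-c)`
(`stdGaussian_not_distortionLE`).

On the line, `k`-Center is approximated by the `k`-th largest gap `δ` between consecutive projected
points. At most `k - 1` gaps exceed `δ`, and cutting there leaves at most `k` clusters of projected
length at most `n δ`, so `OPT ≤ t n δ` (`kCenterOpt_le_of_gaps`). At least `k` gaps are `≥ δ`, and
they separate `k + 1` points at mutual distance at least `δ / t`. Two of these share a center, so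
`OPT ≥ δ / (2t)` (`gap_le_kCenterOpt`). Hence `t n δ = n^(c+4) δ` is a polynomial approximation.

The program projects in `O(nd)` steps and finds `δ` by two bottom-up merge sorts, of the projections
and of the gaps, so that `e = 1` suffices. Its run is analysed for every sequence of samples
(`estimateProg_runs`); chance decides only whether the direction has low distortion. -/

/-! ### Distortion of a one-dimensional Gaussian projection -/

theorem gaussianReal_Icc_le {t : ℝ} (ht : 0 ≤ t) :
    (gaussianReal 0 1).real (Set.Icc (-t) t) ≤ t := by
  -- The maximal density is `1/√(2π)`, and `2π ≥ 4`; the interval has length `2t`.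
  have hpdf : ∀ x, gaussianPDFReal 0 1 x ≤ 1 / 2 := by
    intro x
    rw [gaussianPDFReal_def]
    have h1 : (2 : ℝ) ≤ √(2 * Real.pi * (1 : NNReal)) := by
      apply Real.le_sqrt_of_sq_le
      have := Real.pi_gt_three
      push_cast
      linarith
    have h2 : (√(2 * Real.pi * (1 : NNReal)))⁻¹ ≤ 1 / 2 := by
      rw [one_div]
      exact inv_anti₀ (by norm_num) h1
    have h3 : Real.exp (-(x - 0) ^ 2 / (2 * (1 : NNReal))) ≤ 1 := by
      rw [Real.exp_le_one_iff]
      push_cast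
      have := sq_nonneg (x - 0)
      linarith
    calc _ ≤ (1 / 2 : ℝ) * 1 := by
          apply mul_le_mul h2 h3 (Real.exp_pos _).le (by norm_num)
      _ = _ := by norm_num
  rw [measureReal_def, gaussianReal_apply_eq_integral 0 one_ne_zero, ENNReal.toReal_ofReal
    (integral_nonneg fun x => gaussianPDFReal_nonneg _ _ _)]
  calc ∫ x in Set.Icc (-t) t, gaussianPDFReal 0 1 x
      ≤ ∫ x in Set.Icc (-t) t, (1 / 2 : ℝ) := by
        apply integral_mono (integrable_gaussianPDFReal 0 1).integrableOn
        · exact integrable_const _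
        · exact hpdf
    _ = t := by
        simp
        rw [max_eq_left (by linarith)]
        ring

/-- Chebyshev is enough here: the term `1/t` from small values dominates anyway. -/
theorem gaussianReal_abs_ge_le {t : ℝ} (ht : 0 < t) :
    (gaussianReal 0 1).real {x | t ≤ |x|} ≤ 1 / t ^ 2 := by
  have h := meas_ge_le_variance_div_sq (μ := gaussianReal 0 1) (X := id)
    (memLp_id_gaussianReal 2) ht
  rw [variance_id_gaussianReal] at h
  simp only [id, integral_id_gaussianReal, sub_zero] at h
  rw [measureReal_def]
  refine (ENNReal.toReal_mono ENNReal.ofReal_ne_top h).trans ?_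
  rw [ENNReal.toReal_ofReal (by positivity)]
  simp

theorem stdGaussian_map_inner {E : Type*} [NormedAddCommGroup E] [InnerProductSpace ℝ E]
    [FiniteDimensional ℝ E] [MeasurableSpace E] [BorelSpace E] (u : E) (hu : ‖u‖ = 1) :
    (stdGaussian E).map (fun v => inner ℝ v u) = gaussianReal 0 1 := by
  have h := IsGaussian.map_eq_gaussianReal (μ := stdGaussian E) (innerSL ℝ u)
  rw [integral_strongDual_stdGaussian, variance_dual_stdGaussian] at h
  simp only [innerSL_apply_norm, hu] at h
  have e : (fun v : E => inner ℝ v u) = ⇑(innerSL ℝ u) := by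
    ext v
    simp [real_inner_comm]
  rw [e, h]
  norm_num

/-- After normalising `x - y` to a unit vector `u`, both inequalities depend only on `⟨v, u⟩`, which
is standard normal; they can fail only if its absolute value is at most `1/t` or at least `t`. -/
theorem stdGaussian_inner_distortion {E : Type*} [NormedAddCommGroup E] [InnerProductSpace ℝ E]
    [FiniteDimensional ℝ E] [MeasurableSpace E] [BorelSpace E] (x y : E) {t : ℝ} (ht : 1 ≤ t) :
    (stdGaussian E).real {v | ¬ (dist x y / t ≤ |inner ℝ v x - inner ℝ v y| ∧
      |inner ℝ v x - inner ℝ v y| ≤ dist x y * t)} ≤ 2 / t := by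
  by_cases hxy : x = y
  · subst hxy
    simp
    positivity
  set u : E := (‖x - y‖⁻¹ : ℝ) • (x - y) with hu
  have hn : 0 < ‖x - y‖ := norm_pos_iff.2 (sub_ne_zero.2 hxy)
  have hu1 : ‖u‖ = 1 := by
    rw [hu, norm_smul, norm_inv, norm_norm, inv_mul_cancel₀ hn.ne']
  have hin : ∀ v : E, inner ℝ v x - inner ℝ v y = ‖x - y‖ * inner ℝ v u := by
    intro v
    rw [hu, inner_smul_right, ← mul_assoc, mul_inv_cancel₀ hn.ne', one_mul, inner_sub_right]
  have hmap := stdGaussian_map_inner u hu1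
  have hmeas : Measurable (fun v : E => (inner ℝ v u : ℝ)) := by fun_prop
  have hsub : {v | ¬ (dist x y / t ≤ |inner ℝ v x - inner ℝ v y| ∧
      |inner ℝ v x - inner ℝ v y| ≤ dist x y * t)} ⊆
      (fun v : E => (inner ℝ v u : ℝ)) ⁻¹' (Set.Icc (-(1 / t)) (1 / t) ∪ {x | t ≤ |x|}) := by
    intro v hv
    by_contra hcon
    apply hv
    simp only [Set.mem_preimage, Set.mem_union, Set.mem_Icc, Set.mem_ofPred_eq, not_or,
      ← abs_le, not_le] at hcon
    rw [hin, abs_mul, abs_norm, dist_eq_norm, div_eq_mul_one_div]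
    exact ⟨mul_le_mul_of_nonneg_left hcon.1.le hn.le, mul_le_mul_of_nonneg_left hcon.2.le hn.le⟩
  have hm1 : MeasurableSet {x : ℝ | t ≤ |x|} :=
    measurableSet_le measurable_const (by fun_prop)
  calc _ ≤ (stdGaussian E).real ((fun v : E => (inner ℝ v u : ℝ)) ⁻¹'
          (Set.Icc (-(1 / t)) (1 / t) ∪ {x | t ≤ |x|})) := measureReal_mono hsub
    _ = (gaussianReal 0 1).real (Set.Icc (-(1 / t)) (1 / t) ∪ {x | t ≤ |x|}) := by
        rw [← hmap, map_measureReal_apply hmeas (measurableSet_Icc.union hm1)]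
    _ ≤ 1 / t + 1 / t ^ 2 := by
        refine (measureReal_union_le _ _).trans (add_le_add ?_ ?_)
        · exact gaussianReal_Icc_le (by positivity)
        · exact gaussianReal_abs_ge_le (by linarith)
    _ ≤ 1 / t + 1 / t := by
        gcongr
        nlinarith
    _ = 2 / t := by ring

/-- `v` distorts all pairwise distances of `P` by at most the factor `t`. -/
def DistortionLE {E : Type*} [NormedAddCommGroup E] [InnerProductSpace ℝ E] (P : Set E) (t : ℝ)
    (v : E) : Prop :=
  ∀ x ∈ P, ∀ y ∈ P, dist x y / t ≤ |inner ℝ v x - inner ℝ v y| ∧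
    |inner ℝ v x - inner ℝ v y| ≤ dist x y * t

theorem stdGaussian_not_distortionLE {n d : ℕ} (hn : 0 < n) (c : ℕ)
    (p : Fin n → EuclideanSpace ℝ (Fin d)) :
    (stdGaussian (EuclideanSpace ℝ (Fin d))).real
      {v | ¬ DistortionLE (Set.range p) ((n : ℝ) ^ (c + 3)) v} ≤ 1 / (n : ℝ) ^ c := by
  obtain rfl | hn2 : n = 1 ∨ 2 ≤ n := by omega
  · simp [measureReal_le_one]
  have hn1 : (2 : ℝ) ≤ n := by exact_mod_cast hn2
  have ht : (1 : ℝ) ≤ (n : ℝ) ^ (c + 3) := one_le_pow₀ (by linarith)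
  have hsub : {v | ¬ DistortionLE (Set.range p) ((n : ℝ) ^ (c + 3)) v} ⊆
      ⋃ ij : Fin n × Fin n, {v | ¬ (dist (p ij.1) (p ij.2) / (n : ℝ) ^ (c + 3) ≤
          |inner ℝ v (p ij.1) - inner ℝ v (p ij.2)| ∧
        |inner ℝ v (p ij.1) - inner ℝ v (p ij.2)| ≤
          dist (p ij.1) (p ij.2) * (n : ℝ) ^ (c + 3))} := by
    intro v hv
    by_contra hcon
    apply hv
    rintro _ ⟨i, rfl⟩ _ ⟨j, rfl⟩
    simp only [Set.mem_iUnion, not_exists, Set.mem_ofPred_eq, not_not] at hcon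
    exact hcon (i, j)
  calc _ ≤ _ := measureReal_mono hsub
    _ ≤ _ := measureReal_iUnion_fintype_le _
    _ ≤ ∑ ij : Fin n × Fin n, 2 / (n : ℝ) ^ (c + 3) :=
        Finset.sum_le_sum fun ij _ => stdGaussian_inner_distortion _ _ ht
    _ = (2 / n) * (1 / (n : ℝ) ^ c) := by
        simp
        field_simp
        ring
    _ ≤ 1 * (1 / (n : ℝ) ^ c) := by
        gcongr
        rw [div_le_one (by linarith)]
        exact hn1
    _ = _ := one_mul _

theorem measurableSet_distortionLE {n d : ℕ} (p : Fin n → EuclideanSpace ℝ (Fin d)) (t : ℝ) :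
    MeasurableSet {v | DistortionLE (Set.range p) t v} := by
  simp only [DistortionLE, Set.forall_mem_range, Set.ofPred_forall]
  refine MeasurableSet.iInter fun i => MeasurableSet.iInter fun j => ?_
  have hf : Measurable fun v : EuclideanSpace ℝ (Fin d) =>
      |inner ℝ v (p i) - inner ℝ v (p j)| := by fun_prop
  exact (measurableSet_le measurable_const hf).inter (measurableSet_le hf measurable_const)

/-- Carries the distortion bound over to the direction formed by the first `d` samples of the
program. -/
theorem RealRAM.gaussianSamples_map_toLp (d : ℕ) :
    RealRAM.gaussianSamples.map (fun ω => WithLp.toLp 2 (fun i : Fin d => ω i)) =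
      stdGaussian (EuclideanSpace ℝ (Fin d)) := by
  have hm : Measurable (fun (ω : ℕ → ℝ) (i : Fin d) => ω i) := by fun_prop
  have h1 : RealRAM.gaussianSamples.map (fun ω (i : Fin d) => ω i) =
      Measure.pi (fun _ : Fin d => gaussianReal 0 1) := by
    symm
    apply Measure.pi_eq
    intro s hs
    rw [Measure.map_apply hm (MeasurableSet.univ_pi hs)]
    -- The preimage of a box is a cylinder over the finite index set `range d`, whose infinite
    -- product measure is a finite product.
    have e : (fun (ω : ℕ → ℝ) (i : Fin d) => ω i) ⁻¹' Set.univ.pi s =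
        Set.pi (Finset.range d : Set ℕ) (fun j => if h : j < d then s ⟨j, h⟩ else Set.univ) := by
      ext ω
      simp only [Set.mem_preimage, Set.mem_pi, Set.mem_univ, true_imp_iff, Finset.coe_range,
        Set.mem_Iio]
      constructor
      · intro h j hj
        simpa [hj] using h ⟨j, hj⟩
      · intro h i
        simpa using h i i.2
    rw [e, RealRAM.gaussianSamples, Measure.infinitePi_pi, Finset.prod_range]
    · simp
    · intro j hj
      rw [Finset.mem_range] at hj
      simpa [hj] using hs ⟨j, hj⟩
  rw [← map_pi_eq_stdGaussian, ← h1, Measure.map_map (by fun_prop) hm]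
  rfl

instance : IsProbabilityMeasure RealRAM.gaussianSamples := by
  unfold RealRAM.gaussianSamples
  infer_instance

theorem RealRAM.gaussianSamples_not_distortionLE {n d : ℕ} (hn : 0 < n) (c : ℕ)
    (p : Fin n → EuclideanSpace ℝ (Fin d)) :
    RealRAM.gaussianSamples.real {ω | ¬ DistortionLE (Set.range p) ((n : ℝ) ^ (c + 3))
      (WithLp.toLp 2 (fun i : Fin d => ω i))} ≤ 1 / (n : ℝ) ^ c := by
  refine le_trans (le_of_eq ?_) (stdGaussian_not_distortionLE hn c p)
  rw [← RealRAM.gaussianSamples_map_toLp, map_measureReal_apply (by fun_prop)]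
  · rfl
  · exact (measurableSet_distortionLE p _).compl

/-! ### Rearrangements and order statistics -/

/-- The first `n` entries of `b` are the first `n` entries of `a` in some order. -/
def SameEntries (n : ℕ) (b a : ℕ → ℝ) : Prop :=
  ∀ f : ℝ → ℕ, ∑ x ∈ Finset.range n, f (b x) = ∑ x ∈ Finset.range n, f (a x)

/-- The first `n` entries of `b` are the first `n` entries of `a` in increasing order. -/
structure IsSortOf (n : ℕ) (b a : ℕ → ℝ) : Prop where
  mono : ∀ x y, x ≤ y → y < n → b x ≤ b y
  same : SameEntries n b a

theorem SameEntries.symm {n : ℕ} {b a : ℕ → ℝ} (h : SameEntries n b a) : SameEntries n a b :=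
  fun f => (h f).symm

theorem SameEntries.trans {n : ℕ} {a b c : ℕ → ℝ} (h : SameEntries n a b)
    (h' : SameEntries n b c) : SameEntries n a c :=
  fun f => (h f).trans (h' f)

theorem SameEntries.exists_eq {n : ℕ} {b a : ℕ → ℝ} (h : SameEntries n b a) {i : ℕ}
    (hi : i < n) : ∃ j < n, a j = b i := by
  classical
  by_contra! hcon
  -- The test function is the indicator of the value `b i`: its sum over `b` is positive, so its sum
  -- over `a` cannot vanish.
  have h1 := h fun x => if x = b i then 1 else 0
  have h2 : ∑ x ∈ Finset.range n, (if a x = b i then 1 else 0) = 0 :=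
    Finset.sum_eq_zero fun x hx => if_neg (hcon x (Finset.mem_range.1 hx))
  rw [h2, Finset.sum_eq_zero_iff] at h1
  simpa using h1 i (Finset.mem_range.2 hi)

theorem SameEntries.card_filter {n : ℕ} {b a : ℕ → ℝ} (h : SameEntries n b a) (P : ℝ → Prop)
    [DecidablePred P] :
    ((Finset.range n).filter fun i => P (b i)).card =
      ((Finset.range n).filter fun i => P (a i)).card := by
  rw [Finset.card_filter, Finset.card_filter]
  exact h fun x => if P x then 1 else 0

theorem IsSortOf.le_card_filter_le {n k : ℕ} {b a : ℕ → ℝ} (h : IsSortOf n b a) (hk : k ≤ n) :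
    k ≤ ((Finset.range n).filter fun i => b (n - k) ≤ a i).card := by
  rw [← h.same.card_filter fun x => b (n - k) ≤ x]
  calc k = (Finset.Ico (n - k) n).card := by rw [Nat.card_Ico]; omega
    _ ≤ _ := by
      apply Finset.card_le_card
      intro i hi
      rw [Finset.mem_Ico] at hi
      rw [Finset.mem_filter, Finset.mem_range]
      exact ⟨hi.2, h.mono _ _ hi.1 hi.2⟩

theorem IsSortOf.card_filter_lt_le {n k : ℕ} {b a : ℕ → ℝ} (h : IsSortOf n b a) (hk : k ≤ n)
    (hk1 : 1 ≤ k) : ((Finset.range n).filter fun i => b (n - k) < a i).card ≤ k - 1 := by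
  rw [← h.same.card_filter fun x => b (n - k) < x]
  calc _ ≤ (Finset.Ico (n - k + 1) n).card := by
        apply Finset.card_le_card
        intro i hi
        rw [Finset.mem_filter, Finset.mem_range] at hi
        rw [Finset.mem_Ico]
        refine ⟨?_, hi.1⟩
        by_contra hlt
        exact absurd (h.mono i (n - k) (by omega) (by omega)) (not_le.2 hi.2)
    _ = k - 1 := by rw [Nat.card_Ico]; omega

/-! ### Upper and lower bounds for `k`-Center from gaps on the line -/

section kCenter

variable {E : Type*} [PseudoMetricSpace E]

theorem clusterCost_nonneg (P : Set E) (C : Finset E) : 0 ≤ clusterCost P C :=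
  Real.iSup_nonneg fun _ => Metric.infDist_nonneg

theorem kCenterOpt_nonneg (P : Set E) (k : ℕ) : 0 ≤ kCenterOpt P k :=
  Real.iInf_nonneg fun _ => clusterCost_nonneg _ _

theorem infDist_le_clusterCost {P : Set E} (hP : P.Finite) (C : Finset E) {x : E} (hx : x ∈ P) :
    Metric.infDist x (C : Set E) ≤ clusterCost P C := by
  have := hP.to_subtype
  exact le_ciSup (f := fun p : P => Metric.infDist (p : E) (C : Set E))
    (Set.finite_range _).bddAbove ⟨x, hx⟩

/-- The optimum asks for exactly `k` centers. Surplus centers do no harm, and an infinite space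
always has enough points to pad with. -/
theorem kCenterOpt_le [Infinite E] {P : Set E} {k : ℕ} (C : Finset E) (hC : C.card ≤ k) {r : ℝ}
    (hr : 0 ≤ r) (h : ∀ x ∈ P, ∃ q ∈ C, dist x q ≤ r) : kCenterOpt P k ≤ r := by
  obtain ⟨D, hCD, hD⟩ := Infinite.exists_superset_card_eq C k hC
  have hb : BddBelow (Set.range fun C : {C : Finset E // C.card = k} => clusterCost P C.1) :=
    ⟨0, by rintro _ ⟨C, rfl⟩; exact clusterCost_nonneg _ _⟩
  refine (ciInf_le hb ⟨D, hD⟩).trans (Real.iSup_le ?_ hr)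
  rintro ⟨x, hx⟩
  obtain ⟨q, hq, hxq⟩ := h x hx
  exact (Metric.infDist_le_dist_of_mem (Finset.mem_coe.2 (hCD hq))).trans hxq

/-- If `k + 1` points of `P`, possibly with repetitions, are pairwise at distance at least `2 r`,
then the optimal `k`-Center value is at least `r`. -/
theorem le_kCenterOpt [Infinite E] {ι : Type*} {P : Set E} (hP : P.Finite) {k : ℕ} (hk : 1 ≤ k)
    (S : Finset ι) (hS : k < S.card) (f : ι → E) (hf : ∀ i ∈ S, f i ∈ P) {r : ℝ}
    (h : ∀ i ∈ S, ∀ j ∈ S, i ≠ j → 2 * r ≤ dist (f i) (f j)) : r ≤ kCenterOpt P k := by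
  obtain ⟨D, _, hD⟩ := Infinite.exists_superset_card_eq (∅ : Finset E) k (by simp)
  have : Nonempty {C : Finset E // C.card = k} := ⟨D, hD⟩
  refine le_ciInf ?_
  rintro ⟨C, hC⟩
  -- `infDist` to the empty set is `0` by convention, so a nearest center exists only because `1 ≤
  -- k`.
  have hne : (C : Set E).Nonempty := by
    rw [Finset.coe_nonempty, ← Finset.card_pos]
    omega
  have hnear : ∀ x ∈ P, ∃ q ∈ C, dist x q ≤ clusterCost P C := by
    intro x hx
    obtain ⟨q, hq, hd⟩ := C.finite_toSet.isCompact.exists_infDist_eq_dist hne x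
    exact ⟨q, hq, hd ▸ infDist_le_clusterCost hP C hx⟩
  choose! g hg hgd using hnear
  -- Pigeonhole: two of the more than `k` indices have the same nearest center, and the triangle
  -- inequality bounds their distance by twice the cost.
  obtain ⟨i, hi, j, hj, hij, he⟩ := Finset.exists_ne_map_eq_of_card_lt_of_maps_to
    (s := S) (t := C) (by omega) (f := fun i => g (f i)) (fun i hi => hg _ (hf i hi))
  have h1 := h i hi j hj hij
  have h2 := dist_triangle_right (f i) (f j) (g (f i))
  have h3 := hgd _ (hf i hi)
  have h4 := hgd _ (hf j hj)
  rw [← he] at h4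
  change r ≤ clusterCost P C
  linarith

/-- Centers at the first point and after every gap larger than `δ` of a projection to the line. -/
theorem kCenterOpt_le_of_gaps [Infinite E] {n k : ℕ} (hn : 0 < n) (hk : 1 ≤ k) (p : Fin n → E)
    {y z : ℕ → ℝ} {t δ : ℝ} (ht : 0 ≤ t) (hδ : 0 ≤ δ)
    (hy : ∀ i j : Fin n, dist (p i) (p j) ≤ t * |y i - y j|) (hz : IsSortOf n z y)
    (hgap : ((Finset.range (n - 1)).filter fun i => δ < z (i + 1) - z i).card ≤ k - 1) :
    kCenterOpt (Set.range p) k ≤ t * (n * δ) := by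
  classical
  set B := (Finset.range (n - 1)).filter fun i => δ < z (i + 1) - z i with hB
  have hsrc : ∀ m, ∃ i : Fin n, m < n → y i = z m := by
    intro m
    by_cases hm : m < n
    · obtain ⟨j, hj, e⟩ := hz.same.exists_eq hm
      exact ⟨⟨j, hj⟩, fun _ => e⟩
    · exact ⟨⟨0, hn⟩, fun h => absurd h hm⟩
  choose s hs using hsrc
  -- Walking left from `m` to the nearest center crosses at most `m` gaps, none larger than `δ`.
  have hnear : ∀ m < n, ∃ q ∈ insert 0 (B.image (· + 1)), q ≤ m ∧ z m - z q ≤ m * δ := by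
    intro m
    induction m with
    | zero => exact fun _ => ⟨0, by simp, le_rfl, by simp⟩
    | succ m ih =>
      intro hm
      by_cases hmB : m ∈ B
      · refine ⟨m + 1, ?_, le_rfl, ?_⟩
        · exact Finset.mem_insert_of_mem (Finset.mem_image_of_mem _ hmB)
        · rw [sub_self]; positivity
      · obtain ⟨q, hq, hqm, hd⟩ := ih (by omega)
        refine ⟨q, hq, by omega, ?_⟩
        have h1 : z (m + 1) - z m ≤ δ := by
          by_contra hlt
          apply hmB
          rw [hB, Finset.mem_filter, Finset.mem_range]
          exact ⟨by omega, not_le.1 hlt⟩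
        push_cast
        linarith
  refine kCenterOpt_le ((insert 0 (B.image (· + 1)) : Finset ℕ).image fun q => p (s q)) ?_ (by positivity) ?_
  · calc _ ≤ (insert 0 (B.image (· + 1)) : Finset ℕ).card := Finset.card_image_le
      _ ≤ (B.image (· + 1)).card + 1 := Finset.card_insert_le _ _
      _ ≤ B.card + 1 := Nat.add_le_add_right Finset.card_image_le 1
      _ ≤ k := by omega
  · rintro _ ⟨i, rfl⟩
    obtain ⟨m, hm, e⟩ := hz.same.symm.exists_eq i.2
    obtain ⟨q, hq, hqm, hd⟩ := hnear m hm
    refine ⟨p (s q), Finset.mem_image_of_mem _ hq, (hy _ _).trans ?_⟩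
    rw [hs q (by omega), ← e, abs_of_nonneg (sub_nonneg.2 (hz.mono _ _ hqm hm))]
    have : (m : ℝ) ≤ n := by exact_mod_cast hm.le
    gcongr
    exact hd.trans (by gcongr)

/-- The first sorted point and the right endpoints of the large gaps are at least `k + 1` points.
Any two have a full large gap between them, hence distance at least `δ / t`. The factor `2` comes
from the pigeonhole bound `le_kCenterOpt`. -/
theorem gap_le_kCenterOpt [Infinite E] {n k : ℕ} (hn : 0 < n) (hk : 1 ≤ k) (p : Fin n → E)
    {y z : ℕ → ℝ} {t δ : ℝ} (ht : 0 < t)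
    (hy : ∀ i j : Fin n, |y i - y j| ≤ t * dist (p i) (p j)) (hz : IsSortOf n z y)
    (hgap : k ≤ ((Finset.range (n - 1)).filter fun i => δ ≤ z (i + 1) - z i).card) :
    δ ≤ 2 * t * kCenterOpt (Set.range p) k := by
  classical
  set B := (Finset.range (n - 1)).filter fun i => δ ≤ z (i + 1) - z i with hB
  have hsrc : ∀ m, ∃ i : Fin n, m < n → y i = z m := by
    intro m
    by_cases hm : m < n
    · obtain ⟨j, hj, e⟩ := hz.same.exists_eq hm
      exact ⟨⟨j, hj⟩, fun _ => e⟩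
    · exact ⟨⟨0, hn⟩, fun h => absurd h hm⟩
  choose s hs using hsrc
  have hlt : ∀ q ∈ insert 0 (B.image (· + 1)), ∀ q' ∈ insert 0 (B.image (· + 1)), q < q' →
      δ ≤ t * dist (p (s q)) (p (s q')) := by
    intro q hq q' hq' hqq
    rcases Finset.mem_insert.1 hq' with rfl | hq'
    · omega
    obtain ⟨i, hi, rfl⟩ := Finset.mem_image.1 hq'
    rw [hB, Finset.mem_filter, Finset.mem_range] at hi
    -- Since `q < i + 1`, the position `q` lies at or before the left end `i` of the gap.
    have h1 := hz.mono q i (by omega) (by omega)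
    have h2 := hy (s q) (s (i + 1))
    rw [hs q (by omega), hs (i + 1) (by omega), abs_sub_comm] at h2
    have h3 := le_abs_self (z (i + 1) - z q)
    linarith [hi.2]
  have h := le_kCenterOpt (P := Set.range p) (Set.finite_range p) hk
    (insert 0 (B.image (· + 1))) ?_ (fun q => p (s q)) (fun _ _ => ⟨_, rfl⟩) (r := δ / (2 * t)) ?_
  · rwa [div_le_iff₀' (by positivity)] at h
  · rw [Finset.card_insert_of_notMem (by simp), Finset.card_image_of_injective _
      (add_left_injective 1)]
    omega
  · intro q hq q' hq' hne
    have h1 : δ ≤ t * dist (p (s q)) (p (s q')) := by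
      rcases lt_or_gt_of_ne hne with h | h
      · exact hlt q hq q' hq' h
      · rw [dist_comm]
        exact hlt q' hq' q hq h
    have e : 2 * (δ / (2 * t)) = δ / t := by field_simp
    rw [e, div_le_iff₀' ht]
    exact h1

end kCenter

/-- The value computed from the sorted projection `z` and its sorted gaps `G`. -/
noncomputable def gapEstimate (n k c : ℕ) (G : ℕ → ℝ) : ℝ :=
  if k < n then (n : ℝ) ^ (c + 4) * G (n - 1 - k) else 0

/-- Among `n - 1` gaps in increasing order, index `n - 1 - k` holds the `k`-th largest. With `t =
n^(c+3)` the two gap bounds lose `n t` and `2t`; replacing `2` by `n` gives the exponent `(c+4) + 1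
+ (c+3) = 2c + 8`. -/
theorem kCenterOpt_gapEstimate {E : Type*} [NormedAddCommGroup E] [InnerProductSpace ℝ E]
    [Infinite E] {n k c : ℕ} (hn : 2 ≤ n) (hk : 1 ≤ k) (p : Fin n → E) (v : E)
    (hv : DistortionLE (Set.range p) ((n : ℝ) ^ (c + 3)) v) {y z G : ℕ → ℝ}
    (hy : ∀ i : Fin n, y i = inner ℝ v (p i)) (hz : IsSortOf n z y)
    (hG : IsSortOf (n - 1) G fun i => z (i + 1) - z i) :
    kCenterOpt (Set.range p) k ≤ gapEstimate n k c G ∧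
      gapEstimate n k c G ≤ (n : ℝ) ^ (2 * c + 8) * kCenterOpt (Set.range p) k := by
  classical
  unfold gapEstimate
  have hn0 : (2 : ℝ) ≤ n := by exact_mod_cast hn
  have hopt := kCenterOpt_nonneg (Set.range p) k
  split_ifs with hkn
  · set δ := G (n - 1 - k) with hδ
    have ht : 0 < (n : ℝ) ^ (c + 3) := by positivity
    have hδ0 : 0 ≤ δ := by
      obtain ⟨j, hj, e⟩ := hG.same.exists_eq (i := n - 1 - k) (by omega)
      rw [hδ, ← e]
      exact sub_nonneg.2 (hz.mono _ _ (by omega) (by omega))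
    have h1 := kCenterOpt_le_of_gaps (by omega) hk p ht.le hδ0 (fun i j => by
      rw [hy, hy, ← div_le_iff₀' ht]
      exact (hv _ ⟨i, rfl⟩ _ ⟨j, rfl⟩).1) hz (hG.card_filter_lt_le (by omega) hk)
    have h2 := gap_le_kCenterOpt (by omega) hk p ht (fun i j => by
      rw [hy, hy, mul_comm]
      exact (hv _ ⟨i, rfl⟩ _ ⟨j, rfl⟩).2) hz (hG.le_card_filter_le (by omega))
    constructor
    · refine h1.trans (le_of_eq ?_)
      ring
    · calc _ ≤ (n : ℝ) ^ (c + 4) * (2 * (n : ℝ) ^ (c + 3) * kCenterOpt (Set.range p) k) := by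
            gcongr
        _ ≤ (n : ℝ) ^ (c + 4) * (n * (n : ℝ) ^ (c + 3) * kCenterOpt (Set.range p) k) := by
            gcongr
        _ = _ := by ring
  · refine ⟨?_, by positivity⟩
    -- Here `n ≤ k`: every point can be its own center, and the optimum is `0`.
    refine kCenterOpt_le (Finset.univ.image p) ?_ le_rfl ?_
    · refine Finset.card_image_le.trans ?_
      simp
      omega
    · rintro _ ⟨i, rfl⟩
      exact ⟨p i, Finset.mem_image_of_mem _ (Finset.mem_univ _), by simp⟩

/-! ### Merging sorted runs, independently of the machine -/

/-- `b` arises on the output interval from merging the sorted runs `[lo, mid)` and `[mid, hi)` of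
`a`, of which the entries below `i` and `j` have been consumed. -/
structure MergeInv (a b : ℕ → ℝ) (lo mid hi i j : ℕ) : Prop where
  lo_le : lo ≤ i
  le_mid : i ≤ mid
  mid_le : mid ≤ j
  le_hi : j ≤ hi
  same : ∀ f : ℝ → ℕ, ∑ x ∈ Finset.Ico lo (i + j - mid), f (b x) =
    ∑ x ∈ Finset.Ico lo i, f (a x) + ∑ x ∈ Finset.Ico mid j, f (a x)
  mono : ∀ x y, lo ≤ x → x ≤ y → y < i + j - mid → b x ≤ b y
  left : i < mid → ∀ x, lo ≤ x → x < i + j - mid → b x ≤ a i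
  right : j < hi → ∀ x, lo ≤ x → x < i + j - mid → b x ≤ a j

theorem MergeInv.start {a b : ℕ → ℝ} {lo mid hi : ℕ} (h : lo ≤ mid) (h' : mid ≤ hi) :
    MergeInv a b lo mid hi lo mid where
  lo_le := le_rfl
  le_mid := h
  mid_le := le_rfl
  le_hi := h'
  same := by simp
  mono := by intros; omega
  left := by intros; omega
  right := by intros; omega

/-- The invariant keeps all output below both unread heads. Writing the smaller head preserves this:
it is below its successor because its run is sorted, and below the other head by the comparison. -/
theorem MergeInv.takeLeft {a b : ℕ → ℝ} {lo mid hi i j : ℕ} (h : MergeInv a b lo mid hi i j)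
    (ha : ∀ x y, lo ≤ x → x ≤ y → y < mid → a x ≤ a y) (hi' : i < mid)
    (hle : j < hi → a i ≤ a j) :
    MergeInv a (Function.update b (i + j - mid) (a i)) lo mid hi (i + 1) j := by
  obtain ⟨h1, h2, h3, h4, same, mono, left, right⟩ := h
  have e : i + 1 + j - mid = i + j - mid + 1 := by omega
  have hb : ∀ x, x < i + j - mid → Function.update b (i + j - mid) (a i) x = b x :=
    fun x hx => Function.update_of_ne hx.ne _ _
  have hbo : Function.update b (i + j - mid) (a i) (i + j - mid) = a i := Function.update_self ..
  have hall : ∀ x, lo ≤ x → x < i + j - mid + 1 →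
      Function.update b (i + j - mid) (a i) x ≤ a i := by
    intro x hx hx'
    rcases Nat.lt_succ_iff_lt_or_eq.1 hx' with hx' | rfl
    · rw [hb x hx']
      exact left hi' x hx hx'
    · rw [hbo]
  refine ⟨by omega, by omega, h3, h4, ?_, ?_, ?_, ?_⟩
  · intro f
    rw [e, Finset.sum_Ico_succ_top (by omega), Finset.sum_Ico_succ_top h1, hbo]
    have : ∑ x ∈ Finset.Ico lo (i + j - mid), f (Function.update b (i + j - mid) (a i) x) =
        ∑ x ∈ Finset.Ico lo (i + j - mid), f (b x) :=
      Finset.sum_congr rfl fun x hx => by rw [hb x (Finset.mem_Ico.1 hx).2]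
    rw [this, same]
    ring
  · intro x y hx hxy hy
    rw [e] at hy
    rcases Nat.lt_succ_iff_lt_or_eq.1 hy with hy' | rfl
    · rw [hb x (by omega), hb y hy']
      exact mono x y hx hxy hy'
    · rw [hbo]
      exact hall x hx (by omega)
  · intro hlt x hx hx'
    rw [e] at hx'
    exact (hall x hx hx').trans (ha _ _ h1 (by omega) hlt)
  · intro hlt x hx hx'
    rw [e] at hx'
    exact (hall x hx hx').trans (hle hlt)

theorem MergeInv.takeRight {a b : ℕ → ℝ} {lo mid hi i j : ℕ} (h : MergeInv a b lo mid hi i j)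
    (ha : ∀ x y, mid ≤ x → x ≤ y → y < hi → a x ≤ a y) (hj : j < hi)
    (hle : i < mid → a j ≤ a i) :
    MergeInv a (Function.update b (i + j - mid) (a j)) lo mid hi i (j + 1) := by
  obtain ⟨h1, h2, h3, h4, same, mono, left, right⟩ := h
  have e : i + (j + 1) - mid = i + j - mid + 1 := by omega
  have hb : ∀ x, x < i + j - mid → Function.update b (i + j - mid) (a j) x = b x :=
    fun x hx => Function.update_of_ne hx.ne _ _
  have hbo : Function.update b (i + j - mid) (a j) (i + j - mid) = a j := Function.update_self ..
  have hall : ∀ x, lo ≤ x → x < i + j - mid + 1 →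
      Function.update b (i + j - mid) (a j) x ≤ a j := by
    intro x hx hx'
    rcases Nat.lt_succ_iff_lt_or_eq.1 hx' with hx' | rfl
    · rw [hb x hx']
      exact right hj x hx hx'
    · rw [hbo]
  refine ⟨h1, h2, by omega, by omega, ?_, ?_, ?_, ?_⟩
  · intro f
    rw [e, Finset.sum_Ico_succ_top (by omega), Finset.sum_Ico_succ_top h3, hbo]
    have : ∑ x ∈ Finset.Ico lo (i + j - mid), f (Function.update b (i + j - mid) (a j) x) =
        ∑ x ∈ Finset.Ico lo (i + j - mid), f (b x) :=
      Finset.sum_congr rfl fun x hx => by rw [hb x (Finset.mem_Ico.1 hx).2]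
    rw [this, same]
    ring
  · intro x y hx hxy hy
    rw [e] at hy
    rcases Nat.lt_succ_iff_lt_or_eq.1 hy with hy' | rfl
    · rw [hb x (by omega), hb y hy']
      exact mono x y hx hxy hy'
    · rw [hbo]
      exact hall x hx (by omega)
  · intro hlt x hx hx'
    rw [e] at hx'
    exact (hall x hx hx').trans (hle hlt)
  · intro hlt x hx hx'
    rw [e] at hx'
    exact (hall x hx hx').trans (ha _ _ h3 (by omega) hlt)

/-- Every block of `w` consecutive entries among the first `n` entries of `a` is sorted. -/
def BlocksSorted (n w : ℕ) (a : ℕ → ℝ) : Prop :=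
  ∀ x y, x ≤ y → y < n → x / w = y / w → a x ≤ a y

/-- `b` holds the blocks of width `2 w` that result from merging the blocks of width `w` of `a`,
up to position `m`. -/
structure PassInv (w : ℕ) (a b : ℕ → ℝ) (m : ℕ) : Prop where
  same : SameEntries m b a
  sorted : BlocksSorted m (w + w) b

theorem BlocksSorted.one (n : ℕ) (a : ℕ → ℝ) : BlocksSorted n 1 a := by
  intro x y _ _ h
  rw [Nat.div_one, Nat.div_one] at h
  rw [h]

theorem BlocksSorted.mono_of_le {n w : ℕ} {a : ℕ → ℝ} (h : BlocksSorted n w a) (hw : n ≤ w)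
    (x y : ℕ) (hxy : x ≤ y) (hy : y < n) : a x ≤ a y :=
  h x y hxy hy (by rw [Nat.div_eq_of_lt (by omega), Nat.div_eq_of_lt (by omega)])

theorem BlocksSorted.on_block {n w q : ℕ} {a : ℕ → ℝ} (h : BlocksSorted n w a)
    (x y : ℕ) (hx : w * q ≤ x) (hxy : x ≤ y) (hy : y < n) (hy' : y < w * q + w) : a x ≤ a y := by
  refine h x y hxy hy ?_
  rw [Nat.div_eq_of_lt_le (k := q) (by rw [mul_comm]; exact hx)
    (by rw [mul_comm, Nat.mul_succ]; omega), Nat.div_eq_of_lt_le (k := q)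
    (by rw [mul_comm]; omega) (by rw [mul_comm, Nat.mul_succ]; omega)]

/-- `hm` describes a finished merge, with both runs exhausted. The minima with `n` truncate the last
block, whose second run may be short or empty. -/
theorem PassInv.step {n w q : ℕ} {a b b' : ℕ → ℝ} (hw : 0 < w) (hq : (w + w) * q < n)
    (h : PassInv w a b (min ((w + w) * q) n))
    (hm : MergeInv a b' ((w + w) * q) (min n ((w + w) * q + w)) (min n ((w + w) * q + w + w))
      (min n ((w + w) * q + w)) (min n ((w + w) * q + w + w)))
    (hb : ∀ x < (w + w) * q, b' x = b x) :
    PassInv w a b' (min ((w + w) * (q + 1)) n) := by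
  set lo := (w + w) * q with hlo
  have e : (w + w) * (q + 1) = lo + w + w := by rw [hlo]; ring
  rw [e, min_comm]
  set hi := min n (lo + w + w) with hhi
  rw [min_eq_left hq.le] at h
  have hlh : lo ≤ hi := by omega
  have hmono := hm.mono
  have hsame := hm.same
  rw [Nat.add_sub_cancel_left] at hmono hsame
  constructor
  · intro f
    rw [← Finset.sum_range_add_sum_Ico _ hlh, ← Finset.sum_range_add_sum_Ico _ hlh, hsame,
      Finset.sum_Ico_consecutive _ (by omega) (by omega), ← h.same f]
    congr 1
    exact Finset.sum_congr rfl fun x hx => by rw [hb x (Finset.mem_range.1 hx)]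
  · intro x y hxy hy hd
    by_cases hyl : y < lo
    · rw [hb x (by omega), hb y hyl]
      exact h.sorted x y hxy hyl hd
    · refine hmono x y ?_ hxy hy
      -- `x` lies in the same double block as `y`, so it is also at or beyond the start of block
      -- `q`.
      have h1 : q ≤ y / (w + w) := by
        rw [Nat.le_div_iff_mul_le (by omega), mul_comm]
        omega
      rw [← hd, Nat.le_div_iff_mul_le (by omega), mul_comm] at h1
      exact h1

/-! ### Program logic with step bounds, and merge sort -/

namespace RealRAM

/-- Started in `s`, the program `c` halts within `T` steps in a state that satisfies `Q`. -/
def Runs (ω : ℕ → ℝ) (c : Prog) (s : State) (T : ℕ) (Q : State → Prop) : Prop :=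
  ∃ t s', Exec ω c s t s' ∧ t ≤ T ∧ Q s'

variable {ω : ℕ → ℝ}

theorem Runs.mono {c : Prog} {s : State} {T T' : ℕ} {Q Q' : State → Prop}
    (h : Runs ω c s T Q) (hT : T ≤ T') (hQ : ∀ s', Q s' → Q' s') : Runs ω c s T' Q' := by
  obtain ⟨t, s', h1, h2, h3⟩ := h
  exact ⟨t, s', h1, h2.trans hT, hQ _ h3⟩

theorem Runs.seq {c c' : Prog} {s : State} {T T₁ T₂ : ℕ} {Q Q' : State → Prop}
    (h : Runs ω c s T₁ Q') (h' : ∀ s', Q' s' → Runs ω c' s' T₂ Q) (hT : T₁ + T₂ ≤ T) :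
    Runs ω (.seq c c') s T Q := by
  obtain ⟨t, s', h1, h2, h3⟩ := h
  obtain ⟨t', s'', k1, k2, k3⟩ := h' s' h3
  exact ⟨_, s'', h1.seq k1, by omega, k3⟩

theorem Runs.putInt {s : State} {a : ℕ} {i e : IExp} {T : ℕ} {Q : State → Prop}
    (hQ : Q (s.putInt a (i.eval s) (e.eval s))) (hT : i.cost + e.cost + 1 ≤ T) :
    Runs ω (.putInt a i e) s T Q :=
  ⟨_, _, .putInt s a i e, hT, hQ⟩

theorem Runs.putReal {s : State} {a : ℕ} {i : IExp} {e : RExp} {T : ℕ} {Q : State → Prop}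
    (hQ : Q (s.putReal a (i.eval s) (e.eval s))) (hT : i.cost + e.cost + 1 ≤ T) :
    Runs ω (.putReal a i e) s T Q :=
  ⟨_, _, .putReal s a i e, hT, hQ⟩

theorem Runs.gauss {s : State} {a : ℕ} {i : IExp} {T : ℕ} {Q : State → Prop}
    (hQ : Q { s.putReal a (i.eval s) (ω s.drawn) with drawn := s.drawn + 1 })
    (hT : i.cost + 1 ≤ T) : Runs ω (.gauss a i) s T Q :=
  ⟨_, _, .gauss s a i, hT, hQ⟩

theorem Runs.seq_putInt {c : Prog} {s : State} {a : ℕ} {i e : IExp} {T T' : ℕ} {Q : State → Prop}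
    (h : Runs ω c (s.putInt a (i.eval s) (e.eval s)) T' Q)
    (hT : i.cost + e.cost + 1 + T' ≤ T) : Runs ω (.seq (.putInt a i e) c) s T Q :=
  Runs.seq (Q' := fun s' => s' = s.putInt a (i.eval s) (e.eval s)) (.putInt rfl le_rfl)
    (by rintro _ rfl; exact h) hT

theorem Runs.seq_putReal {c : Prog} {s : State} {a : ℕ} {i : IExp} {e : RExp} {T T' : ℕ}
    {Q : State → Prop} (h : Runs ω c (s.putReal a (i.eval s) (e.eval s)) T' Q)
    (hT : i.cost + e.cost + 1 + T' ≤ T) : Runs ω (.seq (.putReal a i e) c) s T Q :=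
  Runs.seq (Q' := fun s' => s' = s.putReal a (i.eval s) (e.eval s)) (.putReal rfl le_rfl)
    (by rintro _ rfl; exact h) hT

theorem Runs.seq_gauss {c : Prog} {s : State} {a : ℕ} {i : IExp} {T T' : ℕ} {Q : State → Prop}
    (h : Runs ω c { s.putReal a (i.eval s) (ω s.drawn) with drawn := s.drawn + 1 } T' Q)
    (hT : i.cost + 1 + T' ≤ T) : Runs ω (.seq (.gauss a i) c) s T Q :=
  Runs.seq (Q' := fun s' => s' = { s.putReal a (i.eval s) (ω s.drawn) with drawn := s.drawn + 1 })
    (.gauss rfl le_rfl) (by rintro _ rfl; exact h) hT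

theorem Runs.branch {b : BExp} {c c' : Prog} {s : State} {T T' : ℕ} {Q : State → Prop}
    (h : b.holds s → Runs ω c s T' Q) (h' : ¬ b.holds s → Runs ω c' s T' Q)
    (hT : b.cost + T' + 1 ≤ T) : Runs ω (.branch b c c') s T Q := by
  by_cases hb : b.holds s
  · obtain ⟨t, s', h1, h2, h3⟩ := h hb
    exact ⟨_, s', .branchTrue hb h1, by omega, h3⟩
  · obtain ⟨t, s', h1, h2, h3⟩ := h' hb
    exact ⟨_, s', .branchFalse hb h1, by omega, h3⟩

/-- A loop with `N` rounds of at most `τ` steps each, with invariant `I`. -/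
theorem Runs.loop {b : BExp} {c : Prog} {s : State} {N τ T : ℕ} (I : ℕ → State → Prop)
    (h0 : I 0 s) (hb : ∀ i s, I i s → i ≤ N → (b.holds s ↔ i < N))
    (hc : ∀ i s, I i s → i < N → Runs ω c s τ (I (i + 1)))
    (hT : N * (τ + b.cost + 1) + b.cost + 1 ≤ T) : Runs ω (.loop b c) s T (I N) := by
  -- Induction on the number `m` of rounds still to come.
  have key : ∀ m i s, i + m = N → I i s →
      Runs ω (.loop b c) s (m * (τ + b.cost + 1) + b.cost + 1) (I N) := by
    intro m
    induction m with
    | zero =>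
      intro i s hi hI
      obtain rfl : i = N := by omega
      refine ⟨_, s, .loopFalse ?_, by omega, hI⟩
      rw [hb i s hI le_rfl]
      exact lt_irrefl i
    | succ m ih =>
      intro i s hi hI
      obtain ⟨t, s', h1, h2, h3⟩ := hc i s hI (by omega)
      obtain ⟨t', s'', k1, k2, k3⟩ := ih (i + 1) s' (by omega) h3
      refine ⟨_, s'', .loopTrue ((hb i s hI (by omega)).2 (by omega)) h1 k1, ?_, k3⟩
      rw [Nat.succ_mul]
      omega
  exact (key N 0 s (by omega) h0).mono hT fun _ h => h

/-- Cell `0` of the integer array `x`, used as an integer variable. -/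
def var (x : ℕ) : IExp := .get x (.const 0)

@[simp] theorem eval_var (s : State) (x : ℕ) : (var x).eval s = s.ints x 0 := rfl

@[simp] theorem cost_var (x : ℕ) : (var x).cost = 2 := rfl

def setVar (x : ℕ) (e : IExp) : Prog := .putInt x (.const 0) e

/-- `min e f`, through truncated subtraction. -/
def minExp (e f : IExp) : IExp := .minus e (.minus e f)

@[simp] theorem eval_minExp (s : State) (e f : IExp) :
    (minExp e f).eval s = min (e.eval s) (f.eval s) := by
  simp only [minExp, IExp.eval]
  omega

/-! Integer variables of the sorting program: `1` the length, `2` the width of the sorted blocks,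
`3`, `6`, `7` the ends of the two blocks that are merged, `4` and `5` the reading positions. The
entries are in real array `3`, and real array `4` is a buffer. -/

def mergeBody : Prog :=
  .branch (.both (.intLt (var 4) (var 6)) (.neg (.both (.intLt (var 5) (var 7))
      (.realLt (.get 3 (var 5)) (.get 3 (var 4))))))
    (.seq (.putReal 4 (.minus (.plus (var 4) (var 5)) (var 6)) (.get 3 (var 4)))
      (setVar 4 (.plus (var 4) (.const 1))))
    (.seq (.putReal 4 (.minus (.plus (var 4) (var 5)) (var 6)) (.get 3 (var 5)))
      (setVar 5 (.plus (var 5) (.const 1))))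

def mergeLoop : Prog := .loop (.intLt (.plus (var 4) (var 5)) (.plus (var 6) (var 7))) mergeBody

def blockBody : Prog :=
  .seq (setVar 4 (var 3)) <|
  .seq (setVar 6 (minExp (var 1) (.plus (var 3) (var 2)))) <|
  .seq (setVar 7 (minExp (var 1) (.plus (.plus (var 3) (var 2)) (var 2)))) <|
  .seq (setVar 5 (var 6)) <|
  .seq mergeLoop <|
  setVar 3 (.plus (.plus (var 3) (var 2)) (var 2))

def copyLoop : Prog :=
  .loop (.intLt (var 4) (var 1))
    (.seq (.putReal 3 (var 4) (.get 4 (var 4))) (setVar 4 (.plus (var 4) (.const 1))))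

def passBody : Prog :=
  .seq (setVar 3 (.const 0)) <|
  .seq (.loop (.intLt (var 3) (var 1)) blockBody) <|
  .seq (setVar 4 (.const 0)) <|
  .seq copyLoop <|
  setVar 2 (.plus (var 2) (var 2))

def sortProg : Prog :=
  .seq (setVar 2 (.const 1)) (.loop (.intLt (var 2) (var 1)) passBody)

/-- Every round consumes exactly one entry, so the sum of the two reading positions counts the
rounds, of which there are `hi - lo`. -/
theorem mergeLoop_runs (s : State) {lo mid hi : ℕ} (h4 : s.ints 4 0 = lo) (h5 : s.ints 5 0 = mid)
    (h6 : s.ints 6 0 = mid) (h7 : s.ints 7 0 = hi) (hlm : lo ≤ mid) (hmh : mid ≤ hi)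
    (hl : ∀ x y, lo ≤ x → x ≤ y → y < mid → s.reals 3 x ≤ s.reals 3 y)
    (hr : ∀ x y, mid ≤ x → x ≤ y → y < hi → s.reals 3 x ≤ s.reals 3 y) :
    Runs ω mergeLoop s (80 * (hi - lo) + 20) fun s' =>
      MergeInv (s.reals 3) (s'.reals 4) lo mid hi mid hi ∧
      (∀ x < lo, s'.reals 4 x = s.reals 4 x) ∧ s'.reals 3 = s.reals 3 ∧
      s'.ints 0 = s.ints 0 ∧ s'.ints 1 = s.ints 1 ∧ s'.ints 2 = s.ints 2 ∧
      s'.ints 3 = s.ints 3 := by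
  refine (Runs.loop (N := hi - lo) (τ := 50) (T := 80 * (hi - lo) + 20)
    (fun m s' => MergeInv (s.reals 3) (s'.reals 4) lo mid hi (s'.ints 4 0) (s'.ints 5 0) ∧
      s'.ints 4 0 + s'.ints 5 0 = lo + mid + m ∧ s'.ints 6 0 = mid ∧ s'.ints 7 0 = hi ∧
      (∀ x < lo, s'.reals 4 x = s.reals 4 x) ∧ s'.reals 3 = s.reals 3 ∧
      s'.ints 0 = s.ints 0 ∧ s'.ints 1 = s.ints 1 ∧ s'.ints 2 = s.ints 2 ∧
      s'.ints 3 = s.ints 3) ?_ ?_ ?_ ?_).mono le_rfl ?_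
  · rw [h4, h5]
    exact ⟨.start hlm hmh, by simp, h6, h7, by simp⟩
  · rintro m s' ⟨-, h1, h2, h3, -⟩ hm
    simp only [BExp.holds, IExp.eval, eval_var, h1, h2, h3]
    omega
  · rintro m s' ⟨inv, e1, e2, e3, e4, e5, e6⟩ hm
    have i1 := inv.lo_le
    have i2 := inv.le_mid
    have i3 := inv.mid_le
    have i4 := inv.le_hi
    have hfr : ∀ v, ∀ x < lo, Function.update (s'.reals 4)
        (s'.ints 4 0 + s'.ints 5 0 - mid) v x = s.reals 4 x := by
      intro v x hx
      rw [Function.update_of_ne (by omega), e4 x hx]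
    refine Runs.branch (T' := 20) ?_ ?_ (by simp [BExp.cost, RExp.cost])
    · intro hb
      simp only [BExp.holds, RExp.eval, eval_var, e2, e3, e5, not_and, not_lt] at hb
      refine Runs.seq_putReal (T' := 7) (Runs.putInt ?_ ?_) ?_
      · have := inv.takeLeft hl hb.1 hb.2
        simp only [IExp.eval, RExp.eval, eval_var, State.putInt, State.putReal, Function.update_self,
          e2, e5]
        refine ⟨by simpa using this, ?_⟩
        simp [e2, e3, e5, e6]
        exact ⟨by omega, fun x hx => hfr _ x hx⟩
      · simp [IExp.cost]
      · simp [IExp.cost, RExp.cost]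
    · intro hb
      simp only [BExp.holds, RExp.eval, eval_var, e2, e3, e5, not_and, not_lt, not_forall,
        not_le] at hb
      -- If the left run is exhausted, a remaining round means that the right run is not.
      have hj : s'.ints 5 0 < hi := by
        by_cases hi' : s'.ints 4 0 < mid
        · exact (hb hi').1
        · omega
      refine Runs.seq_putReal (T' := 7) (Runs.putInt ?_ ?_) ?_
      · have := inv.takeRight hr hj fun h => (hb h).2.le
        simp only [IExp.eval, RExp.eval, eval_var, State.putInt, State.putReal, Function.update_self,
          e2, e5]
        refine ⟨by simpa using this, ?_⟩
        simp [e2, e3, e5, e6]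
        exact ⟨by omega, fun x hx => hfr _ x hx⟩
      · simp [IExp.cost]
      · simp [IExp.cost, RExp.cost]
  · simp [BExp.cost, IExp.cost]
    omega
  · rintro s' ⟨inv, h1, h2, h3, h4⟩
    have i1 := inv.le_mid
    have i2 := inv.le_hi
    have e1 : s'.ints 4 0 = mid := by omega
    have e2 : s'.ints 5 0 = hi := by omega
    rw [e1, e2] at inv
    exact ⟨inv, h4⟩


theorem blockBody_runs (s : State) {n w q : ℕ} (hw : 0 < w) (h1 : s.ints 1 0 = n)
    (h2 : s.ints 2 0 = w) (h3 : s.ints 3 0 = (w + w) * q) (hq : (w + w) * q < n)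
    (ha : BlocksSorted n w (s.reals 3))
    (hp : PassInv w (s.reals 3) (s.reals 4) (min ((w + w) * q) n)) :
    Runs ω blockBody s (160 * w + 100) fun s' =>
      PassInv w (s.reals 3) (s'.reals 4) (min ((w + w) * (q + 1)) n) ∧
      s'.ints 3 0 = (w + w) * (q + 1) ∧ s'.reals 3 = s.reals 3 ∧
      s'.ints 0 = s.ints 0 ∧ s'.ints 1 = s.ints 1 ∧ s'.ints 2 = s.ints 2 := by
  have hl : ∀ x y, (w + w) * q ≤ x → x ≤ y → y < min n ((w + w) * q + w) →
      s.reals 3 x ≤ s.reals 3 y := by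
    intro x y hx hxy hy
    -- The `q`-th double block consists of the blocks `2q` and `2q + 1` of width `w`.
    have e : (w + w) * q = w * (2 * q) := by ring
    exact ha.on_block (q := 2 * q) x y (by omega) hxy (by omega) (by omega)
  have hr : ∀ x y, min n ((w + w) * q + w) ≤ x → x ≤ y → y < min n ((w + w) * q + w + w) →
      s.reals 3 x ≤ s.reals 3 y := by
    intro x y hx hxy hy
    have e : (w + w) * q + w = w * (2 * q + 1) := by ring
    exact ha.on_block (q := 2 * q + 1) x y (by omega) hxy (by omega) (by omega)
  refine Runs.seq_putInt (T' := 160 * w + 94) ?_ (by simp [IExp.cost]; omega)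
  refine Runs.seq_putInt (T' := 160 * w + 80) ?_ (by simp [IExp.cost, minExp]; omega)
  refine Runs.seq_putInt (T' := 160 * w + 60) ?_ (by simp [IExp.cost, minExp]; omega)
  refine Runs.seq_putInt (T' := 160 * w + 50) ?_ (by simp [IExp.cost]; omega)
  refine Runs.seq (T₂ := 20) (mergeLoop_runs _ (lo := (w + w) * q)
    (mid := min n ((w + w) * q + w)) (hi := min n ((w + w) * q + w + w))
    ?_ ?_ ?_ ?_ (by omega) (by omega) ?_ ?_) ?_ (by omega)
  · simp [State.putInt, IExp.eval, h3]
  · simp [State.putInt, IExp.eval, h1, h2, h3]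
  · simp [State.putInt, IExp.eval, h1, h2, h3]
  · simp [State.putInt, IExp.eval, h1, h2, h3]
  · simpa [State.putInt] using hl
  · simpa [State.putInt] using hr
  · rintro s' ⟨hm, hlo, e3, e0, e1, e2, e4⟩
    simp [State.putInt] at hm hlo e3 e0 e1 e2 e4
    refine Runs.putInt ?_ (by simp [IExp.cost])
    refine ⟨?_, ?_, ?_⟩
    · simpa [State.putInt] using hp.step hw hq (by simpa using hm) hlo
    · simp [State.putInt, IExp.eval, e4, e2, h2, h3]
      ring
    · simp [State.putInt, IExp.eval, e3, e0, e1, e2]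

theorem copyLoop_runs (s : State) {n : ℕ} (h1 : s.ints 1 0 = n) (h4 : s.ints 4 0 = 0) :
    Runs ω copyLoop s (20 * n + 20) fun s' => (∀ x < n, s'.reals 3 x = s.reals 4 x) ∧
      s'.ints 0 = s.ints 0 ∧ s'.ints 1 = s.ints 1 ∧ s'.ints 2 = s.ints 2 := by
  refine (Runs.loop (N := n) (τ := 14) (T := 20 * n + 20)
    (fun m s' => s'.ints 4 0 = m ∧ s'.reals 4 = s.reals 4 ∧
      (∀ x < m, s'.reals 3 x = s.reals 4 x) ∧
      s'.ints 0 = s.ints 0 ∧ s'.ints 1 = s.ints 1 ∧ s'.ints 2 = s.ints 2) ?_ ?_ ?_ ?_).mono le_rfl ?_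
  · simp [h4]
  · rintro m s' ⟨e4, -, -, -, e1, -⟩ hm
    simp [BExp.holds, e4, e1, h1]
  · rintro m s' ⟨e4, er, hx, e0, e1, e2⟩ hm
    refine Runs.seq_putReal (T' := 7) (Runs.putInt ?_ (by simp [IExp.cost]))
      (by simp [RExp.cost])
    simp [State.putInt, State.putReal, IExp.eval, RExp.eval, e4, er, e0, e1, e2]
    intro x hxm
    rw [Function.update_apply]
    split_ifs with h
    · rw [h]
    · exact hx x (by omega)
  · simp [BExp.cost]
    omega
  · rintro s' ⟨-, -, h⟩
    exact h

theorem passBody_runs (s : State) {n w : ℕ} (hw : 0 < w) (hwn : w < n) (h1 : s.ints 1 0 = n)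
    (h2 : s.ints 2 0 = w) (ha : BlocksSorted n w (s.reals 3)) :
    Runs ω passBody s (600 * n + 200) fun s' =>
      SameEntries n (s'.reals 3) (s.reals 3) ∧ BlocksSorted n (w + w) (s'.reals 3) ∧
      s'.ints 2 0 = w + w ∧ s'.ints 0 = s.ints 0 ∧ s'.ints 1 = s.ints 1 := by
  -- The number of double blocks, `n / (2w)` rounded up.
  set N := (n + (w + w - 1)) / (w + w) with hN
  have hNq : ∀ q, q < N ↔ (w + w) * q < n := by
    intro q
    rw [hN, ← Nat.succ_le_iff, Nat.le_div_iff_mul_le (by omega), Nat.succ_mul, mul_comm]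
    omega
  -- Rounding up costs less than one double block, and `w < n`. This makes the total merging cost of
  -- a pass linear in `n`.
  have hNw : 2 * (N * w) ≤ 3 * n := by
    have := Nat.div_mul_le_self (n + (w + w - 1)) (w + w)
    rw [← hN, mul_add] at this
    omega
  have hN1 : N ≤ N * w := Nat.le_mul_of_pos_right N hw
  have hNn : n ≤ (w + w) * N := by
    by_contra hlt
    exact lt_irrefl N ((hNq N).2 (not_le.1 hlt))
  refine Runs.seq_putInt (T' := 600 * n + 190) ?_ (by simp [IExp.cost]; omega)
  refine Runs.seq (T₁ := 500 * n + 20) (T₂ := 20 * n + 100)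
    (Runs.loop (N := N) (τ := 160 * w + 100) (fun q s' =>
      PassInv w (s.reals 3) (s'.reals 4) (min ((w + w) * q) n) ∧
      s'.ints 3 0 = (w + w) * q ∧ s'.reals 3 = s.reals 3 ∧
      s'.ints 0 = s.ints 0 ∧ s'.ints 1 = s.ints 1 ∧ s'.ints 2 = s.ints 2) ?_ ?_ ?_ ?_) ?_ (by omega)
  · refine ⟨⟨?_, ?_⟩, ?_⟩
    · simp [SameEntries]
    · intro x y _ h
      simp at h
    · simp [State.putInt, IExp.eval]
  · rintro q s' ⟨-, e3, -, -, e1, -⟩ -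
    simp [BExp.holds, e3, e1, h1, hNq]
  · rintro q s' ⟨inv, e3, er, e0, e1, e2⟩ hq
    refine (blockBody_runs s' hw (by rw [e1, h1]) (by rw [e2, h2]) e3 ((hNq q).1 hq)
      (by rwa [er]) (by rwa [er])).mono le_rfl ?_
    rintro s'' ⟨inv', k3, kr, k0, k1, k2⟩
    rw [er] at inv' kr
    exact ⟨inv', k3, kr, k0.trans e0, k1.trans e1, k2.trans e2⟩
  · simp [BExp.cost]
    have : N * (160 * w + 100 + 5 + 1) = 160 * (N * w) + 106 * N := by ring
    rw [this]
    omega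
  · rintro s' ⟨⟨same, sorted⟩, -, er, e0, e1, e2⟩
    rw [min_eq_right hNn] at same sorted
    refine Runs.seq_putInt (T' := 20 * n + 50) ?_ (by simp [IExp.cost]; omega)
    refine Runs.seq (T₂ := 20) (copyLoop_runs _ (n := n) ?_ ?_) ?_ (by omega)
    · simp [State.putInt, e1, h1]
    · simp [State.putInt, IExp.eval]
    · rintro t ⟨hx, k0, k1, k2⟩
      simp [State.putInt] at hx k0 k1 k2
      refine Runs.putInt ?_ (by simp [IExp.cost])
      simp [State.putInt, IExp.eval, k0, k1, k2, e0, e1, e2, h2]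
      constructor
      · intro f
        rw [← same f]
        exact Finset.sum_congr rfl fun x h => by rw [hx x (Finset.mem_range.1 h)]
      · intro x y hxy hy hd
        rw [hx x (by omega), hx y hy]
        exact sorted x y hxy hy hd

/-- The block width doubles in each pass, from `1` until it reaches `n`, which takes `clog 2 n`
passes of linear cost. -/
theorem sortProg_runs (s : State) {n : ℕ} (h1 : s.ints 1 0 = n) :
    Runs ω sortProg s (Nat.clog 2 n * (600 * n + 300) + 20) fun s' =>
      IsSortOf n (s'.reals 3) (s.reals 3) ∧ s'.ints 0 = s.ints 0 ∧ s'.ints 1 = s.ints 1 := by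
  refine Runs.seq_putInt (T' := Nat.clog 2 n * (600 * n + 300) + 10) ?_ (by simp [IExp.cost]; omega)
  refine (Runs.loop (N := Nat.clog 2 n) (τ := 600 * n + 200)
    (T := Nat.clog 2 n * (600 * n + 300) + 10) (fun m s' =>
      SameEntries n (s'.reals 3) (s.reals 3) ∧ BlocksSorted n (2 ^ m) (s'.reals 3) ∧
      s'.ints 2 0 = 2 ^ m ∧ s'.ints 0 = s.ints 0 ∧ s'.ints 1 = s.ints 1) ?_ ?_ ?_ ?_).mono le_rfl ?_
  · simp [State.putInt, IExp.eval, BlocksSorted.one, SameEntries]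
  · rintro m s' ⟨-, -, e2, -, e1⟩ -
    simp [BExp.holds, e2, e1, h1, Nat.lt_clog_iff_pow_lt]
  · rintro m s' ⟨same, sorted, e2, e0, e1⟩ hm
    refine (passBody_runs s' (by positivity) ((Nat.lt_clog_iff_pow_lt one_lt_two).1 hm)
      (by rw [e1, h1]) e2 sorted).mono le_rfl ?_
    rintro t ⟨same', sorted', k2, k0, k1⟩
    rw [← two_mul, ← pow_succ'] at sorted' k2
    exact ⟨same'.trans same, sorted', k2, k0.trans e0, k1.trans e1⟩
  · have : Nat.clog 2 n * (600 * n + 200 + (2 + 2 + 1) + 1) ≤ Nat.clog 2 n * (600 * n + 300) :=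
      Nat.mul_le_mul_left _ (by omega)
    simp only [BExp.cost, cost_var]
    omega
  · rintro s' ⟨same, sorted, -, e⟩
    exact ⟨⟨sorted.mono_of_le (Nat.le_pow_clog one_lt_two n), same⟩, e⟩


/-! The whole program. Real array `2` holds the random direction, cell `0` of real array `5` is an
accumulator, and the integer variable `8` points to the next input coordinate. -/

def nExp : IExp := .get 0 (.const 0)

def dExp : IExp := .get 0 (.const 1)

def kExp : IExp := .get 0 (.const 2)

def acc : RExp := .get 5 (.const 0)

def setAcc (e : RExp) : Prog := .putReal 5 (.const 0) e

def incr (x : ℕ) : Prog := setVar x (.plus (var x) (.const 1))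

def sampleProg : Prog :=
  .seq (setVar 4 (.const 0)) (.loop (.intLt (var 4) dExp) (.seq (.gauss 2 (var 4)) (incr 4)))

def dotProg : Prog :=
  .seq (setAcc (.const 0)) <|
  .seq (setVar 4 (.const 0)) <|
  .loop (.intLt (var 4) dExp)
    (.seq (setAcc (.plus acc (.times (.get 0 (var 8)) (.get 2 (var 4)))))
      (.seq (incr 8) (incr 4)))

/-- Integer multiplication is not an instruction, so the address `i * d + j` is tracked by a pointer
that is never reset between points. -/
def projectProg : Prog :=
  .seq (setVar 8 (.const 0)) <|
  .seq (setVar 5 (.const 0)) <|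
  .loop (.intLt (var 5) nExp) (.seq dotProg (.seq (.putReal 3 (var 5) acc) (incr 5)))

def gapProg : Prog :=
  .seq (setVar 4 (.const 0)) <|
  .loop (.intLt (var 4) (var 1))
    (.seq (.putReal 3 (var 4) (.minus (.get 3 (.plus (var 4) (.const 1))) (.get 3 (var 4))))
      (incr 4))

/-- No instruction turns an integer into a real, so the real number `n` is built by `n` additions of
`1`. -/
def castProg : Prog :=
  .seq (setAcc (.const 0)) <|
  .seq (setVar 4 (.const 0)) <|
  .loop (.intLt (var 4) nExp) (.seq (setAcc (.plus acc (.const 1))) (incr 4))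

/-- The exponent is a constant of the program, so the power can be unrolled in its text at a cost
independent of the input. -/
def accPow : ℕ → RExp
  | 0 => .const 1
  | m + 1 => .times (accPow m) acc

theorem eval_accPow (s : State) (m : ℕ) : (accPow m).eval s = s.reals 5 0 ^ m := by
  induction m with
  | zero => simp [accPow, RExp.eval]
  | succ m ih => simp [accPow, RExp.eval, ih, pow_succ, acc, IExp.eval]

theorem cost_accPow (m : ℕ) : (accPow m).cost = 3 * m + 1 := by
  induction m with
  | zero => simp [accPow, RExp.cost]
  | succ m ih => simp [accPow, RExp.cost, ih, acc, IExp.cost]; omega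

def outputProg (c : ℕ) : Prog :=
  .branch (.intLt kExp nExp)
    (.putReal 1 (.const 0)
      (.times (accPow (c + 4)) (.get 3 (.minus (.minus nExp (.const 1)) kExp))))
    (.putReal 1 (.const 0) (.const 0))

def estimateProg (c : ℕ) : Prog :=
  .seq sampleProg <|
  .seq projectProg <|
  .seq (setVar 1 nExp) <|
  .seq sortProg <|
  .seq (setVar 1 (.minus nExp (.const 1))) <|
  .seq gapProg <|
  .seq sortProg <|
  .seq castProg <|
  outputProg c

theorem sampleProg_runs (s : State) (h : s.drawn = 0) :
    Runs ω sampleProg s (20 * s.ints 0 1 + 20) fun s' =>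
      (∀ j < s.ints 0 1, s'.reals 2 j = ω j) ∧ s'.reals 0 = s.reals 0 ∧
      s'.ints 0 = s.ints 0 := by
  refine Runs.seq_putInt (T' := 20 * s.ints 0 1 + 10) ?_ (by simp [IExp.cost]; omega)
  refine (Runs.loop (N := s.ints 0 1) (τ := 10) (T := 20 * s.ints 0 1 + 10)
    (fun m s' => s'.ints 4 0 = m ∧ s'.drawn = m ∧ (∀ j < m, s'.reals 2 j = ω j) ∧
      s'.reals 0 = s.reals 0 ∧ s'.ints 0 = s.ints 0) ?_ ?_ ?_ ?_).mono le_rfl ?_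
  · simp [State.putInt, IExp.eval, h]
  · rintro m s' ⟨e4, -, -, -, e0⟩ -
    simp [BExp.holds, dExp, IExp.eval, e4, e0]
  · rintro m s' ⟨e4, ed, hj, er, e0⟩ hm
    refine Runs.seq_gauss (T' := 6) (Runs.putInt ?_ (by simp [IExp.cost])) (by simp)
    simp [State.putInt, State.putReal, IExp.eval, e4, ed, er, e0]
    intro j hjm
    rw [Function.update_apply]
    split_ifs with h'
    · rw [h']
    · exact hj j (by omega)
  · simp [BExp.cost, dExp, IExp.cost]
    omega
  · rintro s' ⟨-, -, h⟩
    exact h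

theorem dotProg_runs (s : State) :
    Runs ω dotProg s (40 * s.ints 0 1 + 30) fun s' =>
      s'.reals 5 0 = ∑ j ∈ Finset.range (s.ints 0 1),
        s.reals 0 (s.ints 8 0 + j) * s.reals 2 j ∧
      s'.ints 8 0 = s.ints 8 0 + s.ints 0 1 ∧ s'.reals 0 = s.reals 0 ∧ s'.reals 2 = s.reals 2 ∧
      s'.reals 3 = s.reals 3 ∧ s'.ints 0 = s.ints 0 ∧ s'.ints 5 = s.ints 5 := by
  refine Runs.seq_putReal (T' := 40 * s.ints 0 1 + 20) ?_ (by simp [IExp.cost, RExp.cost]; omega)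
  refine Runs.seq_putInt (T' := 40 * s.ints 0 1 + 10) ?_ (by simp [IExp.cost]; omega)
  refine (Runs.loop (N := s.ints 0 1) (τ := 30) (T := 40 * s.ints 0 1 + 10)
    (fun m s' => s'.ints 4 0 = m ∧ s'.reals 5 0 = ∑ j ∈ Finset.range m,
        s.reals 0 (s.ints 8 0 + j) * s.reals 2 j ∧
      s'.ints 8 0 = s.ints 8 0 + m ∧ s'.reals 0 = s.reals 0 ∧ s'.reals 2 = s.reals 2 ∧
      s'.reals 3 = s.reals 3 ∧ s'.ints 0 = s.ints 0 ∧ s'.ints 5 = s.ints 5) ?_ ?_ ?_ ?_).mono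
      le_rfl ?_
  · simp [State.putInt, State.putReal, IExp.eval, RExp.eval]
  · rintro m s' ⟨e4, -, -, -, -, -, e0, -⟩ -
    simp [BExp.holds, dExp, IExp.eval, e4, e0]
  · rintro m s' ⟨e4, er5, e8, er0, er2, er3, e0, e5⟩ hm
    refine Runs.seq_putReal (T' := 15) ?_ (by simp [IExp.cost, RExp.cost, acc])
    refine Runs.seq_putInt (T' := 8) (Runs.putInt ?_ (by simp [IExp.cost])) (by simp [IExp.cost])
    simp [State.putInt, State.putReal, IExp.eval, RExp.eval, acc, e4, er5, e8, er0, er2, er3, e0,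
      e5, Finset.sum_range_succ, add_assoc]
  · simp [BExp.cost, dExp, IExp.cost]
    omega
  · rintro s' ⟨-, h⟩
    exact h

theorem projectProg_runs (s : State) :
    Runs ω projectProg s (s.ints 0 0 * (40 * s.ints 0 1 + 60) + 30) fun s' =>
      (∀ i < s.ints 0 0, s'.reals 3 i = ∑ j ∈ Finset.range (s.ints 0 1),
        s.reals 0 (i * s.ints 0 1 + j) * s.reals 2 j) ∧ s'.ints 0 = s.ints 0 := by
  refine Runs.seq_putInt (T' := s.ints 0 0 * (40 * s.ints 0 1 + 60) + 20) ?_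
    (by simp only [IExp.cost]; omega)
  refine Runs.seq_putInt (T' := s.ints 0 0 * (40 * s.ints 0 1 + 60) + 10) ?_
    (by simp only [IExp.cost]; omega)
  refine (Runs.loop (N := s.ints 0 0) (τ := 40 * s.ints 0 1 + 50)
    (T := s.ints 0 0 * (40 * s.ints 0 1 + 60) + 10)
    (fun m s' => s'.ints 5 0 = m ∧ s'.ints 8 0 = m * s.ints 0 1 ∧ s'.reals 0 = s.reals 0 ∧
      s'.reals 2 = s.reals 2 ∧ (∀ i < m, s'.reals 3 i = ∑ j ∈ Finset.range (s.ints 0 1),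
        s.reals 0 (i * s.ints 0 1 + j) * s.reals 2 j) ∧ s'.ints 0 = s.ints 0) ?_ ?_ ?_ ?_).mono
      le_rfl ?_
  · simp [State.putInt, IExp.eval]
  · rintro m s' ⟨e5, -, -, -, -, e0⟩ -
    simp [BExp.holds, nExp, IExp.eval, e5, e0]
  · rintro m s' ⟨e5, e8, er0, er2, hi, e0⟩ hm
    refine Runs.seq (T₂ := 20) (dotProg_runs s') ?_ (by rw [e0])
    rintro t ⟨k5, k8, kr0, kr2, kr3, k0, k5'⟩
    rw [e0] at k5 k8
    refine Runs.seq_putReal (T' := 8) (Runs.putInt ?_ (by simp [IExp.cost]))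
      (by simp [IExp.cost, RExp.cost, acc])
    simp [State.putInt, State.putReal, IExp.eval, RExp.eval, acc, k5, k8, kr0, kr2, kr3, k0, k5',
      e5, e8, er0, er2, e0, add_mul]
    intro i him
    rw [Function.update_apply]
    split_ifs with h'
    · rw [h']
    · exact hi i (by omega)
  · simp only [BExp.cost, nExp, IExp.cost, cost_var]
    rw [show 40 * s.ints 0 1 + 50 + (2 + (1 + 1) + 1) + 1 = 40 * s.ints 0 1 + 56 by ring]
    have : s.ints 0 0 * (40 * s.ints 0 1 + 56) ≤ s.ints 0 0 * (40 * s.ints 0 1 + 60) :=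
      Nat.mul_le_mul_left _ (by omega)
    omega
  · rintro s' ⟨-, -, -, -, h⟩
    exact h

/-- Overwriting in place is safe from left to right: round `m` reads only cells `m` and `m + 1`,
which still hold their old values. -/
theorem gapProg_runs (s : State) :
    Runs ω gapProg s (30 * s.ints 1 0 + 20) fun s' =>
      (∀ i < s.ints 1 0, s'.reals 3 i = s.reals 3 (i + 1) - s.reals 3 i) ∧
      s'.ints 0 = s.ints 0 ∧ s'.ints 1 = s.ints 1 := by
  refine Runs.seq_putInt (T' := 30 * s.ints 1 0 + 10) ?_ (by simp [IExp.cost]; omega)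
  refine (Runs.loop (N := s.ints 1 0) (τ := 23) (T := 30 * s.ints 1 0 + 10)
    (fun m s' => s'.ints 4 0 = m ∧
      (∀ i, m ≤ i → s'.reals 3 i = s.reals 3 i) ∧
      (∀ i < m, s'.reals 3 i = s.reals 3 (i + 1) - s.reals 3 i) ∧
      s'.ints 0 = s.ints 0 ∧ s'.ints 1 = s.ints 1) ?_ ?_ ?_ ?_).mono le_rfl ?_
  · simp [State.putInt, IExp.eval]
  · rintro m s' ⟨e4, -, -, -, e1⟩ -
    simp [BExp.holds, e4, e1]
  · rintro m s' ⟨e4, hge, hlt, e0, e1⟩ hm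
    refine Runs.seq_putReal (T' := 7) (Runs.putInt ?_ (by simp [IExp.cost]))
      (by simp [IExp.cost, RExp.cost])
    simp [State.putInt, State.putReal, IExp.eval, RExp.eval, e4, e0, e1]
    constructor
    · intro i hi
      rw [Function.update_of_ne (by omega), hge i (by omega)]
    · intro i hi
      rw [Function.update_apply]
      split_ifs with h'
      · rw [h', hge _ (by omega), hge _ le_rfl]
      · exact hlt i (by omega)
  · simp [BExp.cost]
    omega
  · rintro s' ⟨-, -, h⟩
    exact h

theorem castProg_runs (s : State) :
    Runs ω castProg s (30 * s.ints 0 0 + 30) fun s' =>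
      s'.reals 5 0 = (s.ints 0 0 : ℝ) ∧ s'.reals 3 = s.reals 3 ∧ s'.ints 0 = s.ints 0 := by
  refine Runs.seq_putReal (T' := 30 * s.ints 0 0 + 20) ?_ (by simp [IExp.cost, RExp.cost]; omega)
  refine Runs.seq_putInt (T' := 30 * s.ints 0 0 + 10) ?_ (by simp [IExp.cost]; omega)
  refine (Runs.loop (N := s.ints 0 0) (τ := 20) (T := 30 * s.ints 0 0 + 10)
    (fun m s' => s'.ints 4 0 = m ∧ s'.reals 5 0 = (m : ℝ) ∧ s'.reals 3 = s.reals 3 ∧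
      s'.ints 0 = s.ints 0) ?_ ?_ ?_ ?_).mono le_rfl ?_
  · simp [State.putInt, State.putReal, IExp.eval, RExp.eval]
  · rintro m s' ⟨e4, -, -, e0⟩ -
    simp [BExp.holds, nExp, IExp.eval, e4, e0]
  · rintro m s' ⟨e4, er5, er3, e0⟩ hm
    refine Runs.seq_putReal (T' := 8) (Runs.putInt ?_ (by simp [IExp.cost]))
      (by simp [IExp.cost, RExp.cost, acc])
    simp [State.putInt, State.putReal, IExp.eval, RExp.eval, acc, e4, er5, er3, e0]
  · simp [BExp.cost, nExp, IExp.cost]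
    omega
  · rintro s' ⟨-, h⟩
    exact h

theorem outputProg_runs (s : State) (c : ℕ) (h5 : s.reals 5 0 = (s.ints 0 0 : ℝ)) :
    Runs ω (outputProg c) s (3 * c + 50) fun s' =>
      s'.reals 1 0 = gapEstimate (s.ints 0 0) (s.ints 0 2) c (s.reals 3) := by
  refine Runs.branch (T' := 3 * c + 40) ?_ ?_ (by simp [BExp.cost, kExp, nExp, IExp.cost]; omega)
  · intro hb
    refine Runs.putReal ?_ (by simp [cost_accPow, RExp.cost, IExp.cost, nExp, kExp]; omega)
    have hb' : s.ints 0 2 < s.ints 0 0 := by simpa [BExp.holds, kExp, nExp, IExp.eval] using hb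
    simp [State.putReal, IExp.eval, RExp.eval, eval_accPow, h5, gapEstimate, hb', nExp, kExp]
  · intro hb
    refine Runs.putReal ?_ (by simp [RExp.cost, IExp.cost])
    have hb' : ¬ s.ints 0 2 < s.ints 0 0 := by simpa [BExp.holds, kExp, nExp, IExp.eval] using hb
    simp only [gapEstimate, if_neg hb']
    simp [State.putReal, IExp.eval, RExp.eval]

theorem initState_reals {n d : ℕ} (p : Fin n → EuclideanSpace ℝ (Fin d)) (k : ℕ) (i : Fin n)
    (j : Fin d) : (initState p k).reals 0 (i * d + j) = p i j := by
  have h : (i : ℕ) * d + j < n * d := by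
    calc (i : ℕ) * d + j < i * d + d := by omega
      _ = (i + 1) * d := by ring
      _ ≤ n * d := Nat.mul_le_mul_right _ i.2
  have hd : 0 < d := j.pos
  have h1 : (⟨i * d + j, h⟩ : Fin (n * d)).divNat = i := by
    ext
    simp [Fin.divNat, Nat.mul_comm _ d, Nat.mul_add_div hd, Nat.div_eq_of_lt j.2]
  have h2 : (⟨i * d + j, h⟩ : Fin (n * d)).modNat = j := by
    ext
    simp [Fin.modNat, Nat.mul_comm _ d, Nat.mod_eq_of_lt j.2]
  simp only [initState, if_true, dif_pos h, h1, h2]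

/-- A deterministic statement for each `ω`: the time bound and the shape of the output hold even
when the direction is bad. -/
theorem estimateProg_runs {n d : ℕ} (p : Fin n → EuclideanSpace ℝ (Fin d)) (k c : ℕ) :
    Runs ω (estimateProg c) (initState p k)
      (n * (40 * d + 160) + 20 * d + 3 * c + 2 * (Nat.clog 2 n * (600 * n + 300)) + 300)
      fun s' => ∃ y z G : ℕ → ℝ,
        (∀ i : Fin n, y i = inner ℝ (WithLp.toLp 2 fun j : Fin d => ω j) (p i)) ∧
        IsSortOf n z y ∧ IsSortOf (n - 1) G (fun i => z (i + 1) - z i) ∧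
        s'.reals 1 0 = gapEstimate n k c G := by
  have i0 : (initState p k).ints 0 0 = n := rfl
  have i1 : (initState p k).ints 0 1 = d := rfl
  have i2 : (initState p k).ints 0 2 = k := rfl
  set S := Nat.clog 2 n * (600 * n + 300) with hS
  set M := n * (40 * d + 60) with hM
  have hM' : n * (40 * d + 160) = M + 100 * n := by rw [hM]; ring
  rw [hM']
  -- The second sort, of `n - 1` gaps, costs no more than the bound for the first.
  have hS' : Nat.clog 2 (n - 1) * (600 * (n - 1) + 300) ≤ S :=
    Nat.mul_le_mul (Nat.clog_mono_right 2 (Nat.sub_le n 1)) (by omega)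
  clear_value S M
  refine Runs.seq (T₂ := M + 100 * n + 3 * c + 2 * S + 280) (sampleProg_runs _ rfl) ?_
    (by rw [i1]; omega)
  rintro s₁ ⟨a1, a2, a3⟩
  rw [i1] at a1
  refine Runs.seq (T₂ := 100 * n + 3 * c + 2 * S + 250) (projectProg_runs _) ?_
    (by rw [a3, i0, i1]; omega)
  rintro s₂ ⟨b1, b2⟩
  rw [a3, i0, i1] at b1
  rw [a3] at b2
  refine Runs.seq_putInt (T' := 100 * n + 3 * c + 2 * S + 240) ?_ (by simp [IExp.cost, nExp]; omega)
  refine Runs.seq (T₂ := 100 * n + 3 * c + S + 220) (sortProg_runs _ (n := n) ?_) ?_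
    (by rw [← hS]; omega)
  · simp [State.putInt, IExp.eval, nExp, b2, i0]
  rintro s₃ ⟨c1, c2, -⟩
  simp [State.putInt, b2] at c1 c2
  refine Runs.seq_putInt (T' := 100 * n + 3 * c + S + 210) ?_ (by simp [IExp.cost, nExp]; omega)
  have hv : (s₃.putInt 1 ((IExp.const 0).eval s₃)
      ((IExp.minus nExp (.const 1)).eval s₃)).ints 1 0 = n - 1 := by
    simp [State.putInt, IExp.eval, nExp, c2, i0]
  refine Runs.seq (T₂ := 70 * n + 3 * c + S + 190) (gapProg_runs _) ?_ (by rw [hv]; omega)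
  rintro s₄ ⟨d1, d2, d3⟩
  rw [hv] at d1
  refine Runs.seq (T₂ := 70 * n + 3 * c + 170) (sortProg_runs _ (n := n - 1) ?_) ?_
    (by generalize Nat.clog 2 (n - 1) * (600 * (n - 1) + 300) = R at hS' ⊢; omega)
  · rw [d3, hv]
  rintro s₅ ⟨e1, e2, -⟩
  simp [State.putInt, c2] at d1 d2
  rw [d2] at e2
  refine Runs.seq (T₂ := 3 * c + 50) (castProg_runs _) ?_ (by rw [e2, i0]; omega)
  rintro s₆ ⟨f1, f2, f3⟩
  rw [e2] at f1 f3
  refine (outputProg_runs s₆ c (by rw [f1, f3])).mono le_rfl ?_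
  intro s' hs'
  refine ⟨s₂.reals 3, s₃.reals 3, s₅.reals 3, ?_, c1, ⟨e1.mono, ?_⟩, ?_⟩
  · intro i
    rw [b1 i i.2, Finset.sum_range, PiLp.inner_apply]
    refine Finset.sum_congr rfl fun j _ => ?_
    rw [a1 j j.2, a2, initState_reals]
    simp
  · refine e1.same.trans fun f => Finset.sum_congr rfl fun x hx => ?_
    rw [d1 x (Finset.mem_range.1 hx)]
  · rw [hs', f3, f2, i0, i2]

end RealRAM

/-! ### Asymptotic running time and conclusion -/

theorem Nat.clog_two_le_log {n : ℕ} (hn : 0 < n) : (Nat.clog 2 n : ℝ) ≤ 1 + 2 * Real.log n := by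
  have h1 : (1 : ℝ) ≤ n := by exact_mod_cast hn
  have hlog := Real.log_nonneg h1
  have hlog2 : (1 : ℝ) / 2 ≤ Real.log 2 := by
    have := Real.log_two_gt_d9
    linarith
  have h2 : Real.logb 2 n ≤ 2 * Real.log n := by
    rw [Real.logb, div_le_iff₀ (by linarith)]
    nlinarith
  have h3 := Nat.ceil_lt_add_one (Real.logb_nonneg one_lt_two h1)
  have h4 := Real.natCeil_logb_natCast 2 n
  push_cast at h4
  rw [h4] at h3
  linarith

/-- The term `n d` dominates `n`, `d` and `1`, so it absorbs all lower-order costs, including those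
that remain at `n = 1`, where the logarithm vanishes. -/
theorem RealRAM.estimate_time_le {n d : ℕ} (hn : 0 < n) (hd : 0 < d) (c : ℕ) :
    ((n * (40 * d + 160) + 20 * d + 3 * c + 2 * (Nat.clog 2 n * (600 * n + 300)) + 300 : ℕ) : ℝ) ≤
      (3 * c + 3600) * ((n : ℝ) * d + n * Real.log n ^ 1) := by
  have h1 : (1 : ℝ) ≤ n := by exact_mod_cast hn
  have h2 : (1 : ℝ) ≤ d := by exact_mod_cast hd
  have hL := Real.log_nonneg h1
  have hc := Nat.clog_two_le_log hn
  have hc0 : (0 : ℝ) ≤ Nat.clog 2 n := by positivity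
  have hcc : (0 : ℝ) ≤ c := by positivity
  push_cast
  rw [pow_one]
  generalize (n : ℝ) = x at *
  generalize (d : ℝ) = y at *
  generalize (c : ℝ) = z at *
  generalize Real.log x = L at *
  generalize (Nat.clog 2 n : ℝ) = q at *
  have e1 : x ≤ x * y := le_mul_of_one_le_right (by linarith) h2
  have e2 : y ≤ x * y := le_mul_of_one_le_left (by linarith) h1
  have e3 : q * (600 * x + 300) ≤ 900 * (x * y) + 1800 * (x * L) := by
    calc q * (600 * x + 300) ≤ (1 + 2 * L) * (900 * x) := by
          apply mul_le_mul hc <;> linarith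
      _ ≤ _ := by linarith
  have e4 : z ≤ z * (x * y) := le_mul_of_one_le_right hcc (by linarith)
  have e5 : 0 ≤ x * L := by positivity
  have e6 : 0 ≤ z * (x * L) := by positivity
  linarith

theorem mainTheorem6 :
    (∃ e : ℕ, ∀ c : ℕ, ∃ (A : RealRAM.Prog) (a : ℕ) (K : ℝ),
      ∀ (n d k : ℕ) (p : Fin n → EuclideanSpace ℝ (Fin d)),
        0 < n → 0 < d → 1 ≤ k → Function.Injective p →
        ∃ apx : (ℕ → ℝ) → ℝ,
          (∀ ω : ℕ → ℝ, RealRAM.OutputsWithin A p k ω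
            (K * ((n : ℝ) * (d : ℝ) + (n : ℝ) * Real.log (n : ℝ) ^ e)) (apx ω)) ∧
          RealRAM.gaussianSamples.real
            {ω | ¬ (kCenterOpt (Set.range p) k ≤ apx ω ∧
              apx ω ≤ (n : ℝ) ^ a * kCenterOpt (Set.range p) k)} ≤ 1 / (n : ℝ) ^ c) ∧
    (∀ c : ℕ, ∃ a : ℕ, ∀ (n d : ℕ) (p : Fin n → EuclideanSpace ℝ (Fin d)),
      0 < n → 0 < d → Function.Injective p →
      (stdGaussian (EuclideanSpace ℝ (Fin d))).real
        {v | ¬ ∀ x ∈ Set.range p, ∀ y ∈ Set.range p,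
          dist x y / (n : ℝ) ^ a ≤ |inner ℝ v x - inner ℝ v y| ∧
          |inner ℝ v x - inner ℝ v y| ≤ dist x y * (n : ℝ) ^ a} ≤ 1 / (n : ℝ) ^ c) := by
  refine ⟨⟨1, fun c => ⟨RealRAM.estimateProg c, 2 * c + 8, 3 * c + 3600, ?_⟩⟩,
    fun c => ⟨c + 3, fun n d p hn _ _ => stdGaussian_not_distortionLE hn c p⟩⟩
  intro n d k p hn hd hk _
  have hrun := fun ω => RealRAM.estimateProg_runs (ω := ω) p k c
  choose t s hexec ht y z G hy hz hG hout using hrun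
  refine ⟨fun ω => gapEstimate n k c (G ω), fun ω => ⟨t ω, s ω, hexec ω, ?_, hout ω⟩, ?_⟩
  · exact (Nat.cast_le.2 (ht ω)).trans (RealRAM.estimate_time_le hn hd c)
  · obtain rfl | hn2 : n = 1 ∨ 2 ≤ n := by omega
    -- For `n = 1` the allowed failure probability is `1`.
    · simp [measureReal_le_one]
    · have : Nonempty (Fin d) := ⟨⟨0, hd⟩⟩
      have : Infinite (EuclideanSpace ℝ (Fin d)) :=
        Module.Free.infinite ℝ (EuclideanSpace ℝ (Fin d))
      -- Failure of the estimate forces high distortion. Monotonicity needs no measurability, so the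
      -- chosen output function need not be shown measurable.
      refine (measureReal_mono ?_).trans (RealRAM.gaussianSamples_not_distortionLE hn c p)
      intro ω hω hdist
      exact hω (kCenterOpt_gapEstimate hn2 hk p _ hdist (hy ω) (hz ω) (hG ω))
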